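/- Let $\beta,\gamma,\vartheta>0$ and $\mu,\lambda\in\mathbb{R}$, let $\mathfrak{C}:=[-1/2,1/2]^3$ and, for $l\in\mathbb{N}=\{1,2,\dots\}$, let $\Lambda_l:=(\mathbb{Z}\cap[-l,l-1])^3$. For a finite set $\Lambda$ of sites let $\wedge\mathcal{H}_\Lambda$ be the fermion Fock space over $\mathcal{H}_\Lambda=\bigoplus_{x\in\Lambda}\mathbb{C}^2$, with annihilation and creation operators $a_{x,s},a^*_{x,s}$ ($x\in\Lambda$, $s\in\{\uparrow,\downarrow\}$), and let $n_{x,s}:=a^*_{x,s}a_{x,s}$. The magnetization observables $\mathrm{M}^x=(\mathrm{m}^x_1,\mathrm{m}^x_2,\mathrm{m}^x_3)$ are $$\mathrm{m}^x_1:=\vartheta(a^*_{x,\uparrow}a_{x,\downarrow}+a^*_{x,\downarrow}a_{x,\uparrow}),\quad \mathrm{m}^x_2:=i\vartheta(a^*_{x,\downarrow}a_{x,\uparrow}-a^*_{x,\uparrow}a_{x,\downarrow}),\quad \mathrm{m}^x_3:=\vartheta(n_{x,\uparrow}-n_{x,\downarrow}).$$ For $\mathrm{B}\in L^2(\mathfrak{C};\mathbb{R}^3)$,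 extended by $0$ outside $\mathfrak{C}$, consider the Hamiltonian on $\wedge\mathcal{H}_{\Lambda_l}$ $$H_l:=\sum_{x\in\Lambda_l}\Big\{-\mu(n_{x,\uparrow}+n_{x,\downarrow})+2\lambda n_{x,\uparrow}n_{x,\downarrow}\Big\}-\frac{\gamma}{|\Lambda_l|}\sum_{x,y\in\Lambda_l}a^*_{x,\uparrow}a^*_{x,\downarrow}a_{y,\downarrow}a_{y,\uparrow}-\sum_{x\in\Lambda_l}\Big(\int_{\mathfrak{C}}\mathrm{B}\Big(\frac{x+y}{2l}\Big)\mathrm{d}^3y\Big)\cdot\mathrm{M}^x$$ and the finite-volume pressure $$p_l(\mathrm{B}):=(\beta|\Lambda_l|)^{-1}\ln\mathrm{Trace}_{\wedge\mathcal{H}_{\Lambda_l}}(e^{-\beta H_l}).$$ For $r\ge 0$ define $$\mathfrak{F}(r,\mathrm{B}):=-\gamma r+\beta^{-1}\int_{\mathfrak{C}}\ln\mathrm{Trace}_{\wedge\mathcal{H}_{\{0\}}}\big(e^{-\beta u(r,\mathfrak{t})}\big)\,\mathrm{d}^3\mathfrak{t}$$ with the one-site Hamiltonian $$u(r,\mathfrak{t}):=-\mu(n_{0,\uparrow}+n_{0,\downarrow})+2\lambda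 n_{0,\uparrow}n_{0,\downarrow}-\gamma\sqrt{r}\,(a^*_{0,\uparrow}a^*_{0,\downarrow}+a_{0,\downarrow}a_{0,\uparrow})-\mathrm{B}(\mathfrak{t})\cdot\mathrm{M}^0 .$$ (i) For every $\mathrm{B}\in L^2(\mathfrak{C};\mathbb{R}^3)$, the integrand in $\mathfrak{F}(r,\mathrm{B})$ is integrable for every $r\ge0$, and $p_l(\mathrm{B})$ converges as $l\to\infty$, with $$p_\infty(\mathrm{B}):=\lim_{l\to\infty}p_l(\mathrm{B})=\sup_{r\ge 0}\mathfrak{F}(r,\mathrm{B})<\infty .$$ (ii) For all $l\in\mathbb{N}\cup\{\infty\}$ and all $\mathrm{B},\mathrm{C}\in L^2(\mathfrak{C};\mathbb{R}^3)$, $$|p_l(\mathrm{B})-p_l(\mathrm{C})|\le 2\sqrt{3}\,\vartheta\,\|\mathrm{B}-\mathrm{C}\|_2 .$$ -/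

import Mathlib

open MeasureTheory Filter Topology

noncomputable section

namespace BCSHubbard

/-! ### Fermions on a finite set of sites -/

/-- The two spin values. -/
abbrev Spin := Fin 2

/-- Spin up. -/
abbrev up : Spin := 0

/-- Spin down. -/
abbrev dn : Spin := 1

/-- One-particle modes `(x, s)` over a set `X` of sites, ordered lexicographically. The order only
fixes the signs of the occupation number basis of the fermion Fock space. -/
abbrev Mode (X : Type) := X ×ₗ Spin

/-- Linear operators on the fermion Fock space `⋀ H_X`, as matrices in the occupation number basis:
a finite set `S` of modes stands for the wedge product, in increasing order, of the modes in `S`. -/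
abbrev FockOp (X : Type) := Matrix (Finset (Mode X)) (Finset (Mode X)) ℂ

variable {X : Type} [LinearOrder X]

/-- The annihilation operator `a_{x,s}`: it sends the basis vector `T` to `± (T \ {(x,s)})` if
`(x,s) ∈ T`, and to `0` otherwise; the sign is `(-1)` to the number of modes of `T` before
`(x,s)`. -/
def ann (x : X) (s : Spin) : FockOp X :=
  Matrix.of fun S T =>
    if toLex (x, s) ∈ T ∧ S = T.erase (toLex (x, s)) then
      (-1 : ℂ) ^ (T.filter (fun k => k < toLex (x, s))).card
    else 0

/-- The creation operator `a*_{x,s}`, the adjoint of `a_{x,s}`. -/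
def cre (x : X) (s : Spin) : FockOp X := (ann x s).conjTranspose

variable [Fintype X]

/-- The particle number operator `n_{x,s} = a*_{x,s} a_{x,s}`. -/
def num (x : X) (s : Spin) : FockOp X := cre x s * ann x s

/-- The magnetization observables `m_1^x, m_2^x, m_3^x` with coupling `th` (indices `0, 1, 2`). -/
def magn (th : ℝ) (x : X) : Fin 3 → FockOp X :=
  ![(th : ℂ) • (cre x up * ann x dn + cre x dn * ann x up),
    (Complex.I * (th : ℂ)) • (cre x dn * ann x up - cre x up * ann x dn),
    (th : ℂ) • (num x up - num x dn)]

/-- The real number `ln Trace (exp (-β H))`, for a self-adjoint operator `H` (whose trace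
exponential is a positive real number). -/
def logPartition (β : ℝ) (H : FockOp X) : ℝ :=
  Real.log (Matrix.trace (NormedSpace.exp (-(β : ℂ) • H))).re

/-- The strong coupling BCS-Hubbard Hamiltonian `T` on the finite set `X` of sites, without magnetic
induction. -/
def bcsHubbard (X : Type) [LinearOrder X] [Fintype X] (μ lam γ : ℝ) : FockOp X :=
  -(μ : ℂ) • ∑ x : X, (num x up + num x dn)
    + (2 * (lam : ℂ)) • ∑ x : X, num x up * num x dn
    - ((γ : ℂ) / (Fintype.card X : ℂ)) •
        ∑ x : X, ∑ y : X, cre x up * cre x dn * ann y dn * ann y up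

/-! ### The model in the boxes `Λ_l` and its pressure -/

/-- The space `ℝ³` with its Euclidean norm. -/
abbrev E3 := EuclideanSpace ℝ (Fin 3)

/-- The closed unit box `ℭ = [-1/2, 1/2]³`. -/
def unitBox : Set E3 := {t | ∀ i, t i ∈ Set.Icc (-(1 / 2) : ℝ) (1 / 2)}

/-- The real Hilbert space `L²(ℭ; ℝ³)` of magnetic inductions. -/
abbrev L2Box := Lp E3 2 ((volume : Measure E3).restrict unitBox)

/-- The lattice box `Λ_l = (ℤ ∩ [-l, l - 1])³`. -/
def box (l : ℕ) : Finset (Lex (Fin 3 → ℤ)) :=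
  (Fintype.piFinset fun _ : Fin 3 => Finset.Ico (-(l : ℤ)) (l : ℤ)).map toLex.toEmbedding

/-- The lattice point `x` as a point of `ℝ³`. -/
def latticePoint (x : Lex (Fin 3 → ℤ)) : E3 := WithLp.toLp 2 fun i => ((ofLex x i : ℤ) : ℝ)

/-- The `j`-th component of `∫_ℭ B((x + y) / (2l)) d³y`, where `B` is extended by `0` outside the
unit box (the cells around the lattice points `x` with a coordinate `-l` stick out of it). -/
def cellField (l : ℕ) (B : E3 → E3) (x : Lex (Fin 3 → ℤ)) (j : Fin 3) : ℝ :=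
  ∫ y in unitBox, (unitBox.indicator B ((2 * (l : ℝ))⁻¹ • (latticePoint x + y))) j

/-- The magnetic part `M_l` of the Hamiltonian: minus the sum over the sites of the scalar product
of the cell field with the magnetization observables. -/
def magneticTerm (th : ℝ) (l : ℕ) (B : E3 → E3) : FockOp (box l) :=
  -∑ x : box l, ∑ j : Fin 3, (cellField l B x.1 j : ℂ) • magn th x j

/-- The Hamiltonian `H_l = T_l + M_l`. -/
def hamiltonian (μ lam γ th : ℝ) (l : ℕ) (B : E3 → E3) : FockOp (box l) :=
  bcsHubbard (box l) μ lam γ + magneticTerm th l B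

/-- The finite volume pressure `p_l(B) = (β |Λ_l|)⁻¹ ln Trace (exp (-β H_l))`. -/
def pressure (β μ lam γ th : ℝ) (l : ℕ) (B : L2Box) : ℝ :=
  (β * ((box l).card : ℝ))⁻¹ * logPartition β (hamiltonian μ lam γ th l B)

/-- The infinite volume pressure `p_∞(B) = lim_{l → ∞} p_l(B)`. -/
def pressureLim (β μ lam γ th : ℝ) (B : L2Box) : ℝ :=
  limUnder atTop fun l : ℕ => pressure β μ lam γ th l B

/-! ### The one-site variational functional -/

/-- The one-site Hamiltonian `u` for the order parameter `r` and the magnetic induction `b ∈ ℝ³`, on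
the Fock space of a single site. -/
def oneSite (μ lam γ th r : ℝ) (b : E3) : FockOp Unit :=
  -(μ : ℂ) • (num () up + num () dn)
    + (2 * (lam : ℂ)) • (num () up * num () dn)
    - ((γ * Real.sqrt r : ℝ) : ℂ) • (cre () up * cre () dn + ann () dn * ann () up)
    - ∑ j : Fin 3, (b j : ℂ) • magn th () j

/-- The variational functional
`𝔉(r, B) = -γ r + β⁻¹ ∫_ℭ ln Trace (exp (-β u(r, B(t)))) d³t`. -/
def functionalF (β μ lam γ th r : ℝ) (B : L2Box) : ℝ :=
  -γ * r + β⁻¹ * ∫ t in unitBox, logPartition β (oneSite μ lam γ th r (B t))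

end BCSHubbard

end

noncomputable section

namespace BCSHubbard

/-! ### Matrix exponentials -/

section MatrixExp

variable {n : Type*} [Fintype n] [DecidableEq n]

open scoped Matrix Nat ComplexOrder

/-! In each site the field acts only on the singly occupied states, while the BCS term acts only on
the empty and doubly occupied ones. The latter form a quasi-spin 1/2, and the BCS interaction is `γ
/ N` times `S⁺ S⁻` for the total quasi-spin, with `N` the number of sites. Up to factors
subexponential in the volume, the partition function is the supremum over `r` of `exp (-β γ r N)`
times a product of one-site partition functions, and the logarithm of such a product per site is a
Riemann sum for the functional `𝔉`.

Lower bound (`le_partitionFunction`): completing the square, `S⁺ S⁻ ≥ N √r (S⁺ + S⁻) - N² r`, and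
the trace of the exponential is monotone (`trace_exp_mono`). The right side is a sum of one-site
operators, so its exponential factorizes.

Upper bound (`partitionFunction_le`): the partition function is computed exactly
(`partitionFunction_eq`) by splitting the trace according to the set `P` of paired sites, of size
`k`, and the number `m` of doubly occupied ones. The trace of `exp (c S⁺ S⁻)` is a Clebsch-Gordan
sum over spins `k / 2 - j` (`spinTrace_eq`). Each summand is at most `exp (β γ)` times the
mean-field bound at `r = (m - j)(k - m - j) / N²` (`choose_mul_exp_le_pairWeight_pow`). For fixed
`(k, m, j)` the sum over `P` restores a product over the sites, and there are at most `(N + 1)³`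
triples, which disappear after taking the logarithm per volume.

Both bounds see the field through a function of the cell means that is Lipschitz with a constant
independent of `r`; hence the Riemann sums converge uniformly in `r`
(`abs_riemannSum_sub_integral_le`, `tendsto_meanError`) and the pressure is squeezed to the
supremum. In the exact formula the field enters only through products of hyperbolic cosines with
nonnegative coefficients, which gives the Lipschitz bound in `L¹`, hence in `L²` on the unit box. -/

open scoped Matrix.Norms.Operator in
theorem hasSum_matrix_exp (A : Matrix n n ℂ) :
    HasSum (fun k : ℕ => ((k ! : ℂ)⁻¹) • A ^ k) (NormedSpace.exp A) :=
  NormedSpace.exp_series_hasSum_exp' (𝕂 := ℂ) A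

theorem exp_add_of_commute (A B : Matrix n n ℂ) (h : A * B = B * A) :
    NormedSpace.exp (A + B) = NormedSpace.exp A * NormedSpace.exp B :=
  Matrix.exp_add_of_commute A B h

theorem exp_smul_of_idempotent (t : ℂ) {E : Matrix n n ℂ} (hE : E * E = E) :
    NormedSpace.exp (t • E) = 1 + (Complex.exp t - 1) • E := by
  have h1 : HasSum (fun k : ℕ => ((k ! : ℂ)⁻¹ * t ^ k) • E) (Complex.exp t • E) := by
    have := NormedSpace.exp_series_hasSum_exp' (𝕂 := ℂ) t
    rw [← Complex.exp_eq_exp_ℂ] at this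
    exact this.smul_const E
  -- Corrects the constant term of the series: `E ^ 0` is `1`, whereas every other power is `E`.
  have h2 : HasSum (fun k : ℕ => if k = 0 then 1 - E else 0) (1 - E) := by
    simpa using hasSum_ite_eq (0 : ℕ) (1 - E)
  have h3 := h1.add h2
  have h4 := hasSum_matrix_exp (t • E)
  have h5 : (fun k : ℕ => ((k ! : ℂ)⁻¹) • (t • E) ^ k)
      = fun k : ℕ => ((k ! : ℂ)⁻¹ * t ^ k) • E + if k = 0 then 1 - E else 0 := by
    funext k
    rcases k with _ | k
    · simp
    · have : E ^ (k + 1) = E := (show IsIdempotentElem E from hE).pow_succ_eq k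
      simp [smul_pow, this, smul_smul]
  rw [h5] at h4
  rw [h4.unique h3, sub_smul, one_smul]
  abel

/-- The exponential of `t R + Y` for a projection `R` and an operator `Y` on its range whose square
is `c² R`. -/
theorem exists_exp_smul_add_eq (t c : ℂ) {R Y : Matrix n n ℂ} (hR : R * R = R) (hRY : R * Y = Y)
    (hYR : Y * R = Y) (hY : Y * Y = c ^ 2 • R) (h0 : c = 0 → Y = 0) :
    ∃ s : ℂ, NormedSpace.exp (t • R + Y)
      = 1 + (Complex.exp t * Complex.cosh c - 1) • R + s • Y := by
  by_cases hc : c = 0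
  · refine ⟨0, ?_⟩
    simp [h0 hc, hc, exp_smul_of_idempotent t hR]
  -- The spectral projections of `Y` on the range of `R`, for the eigenvalues `c` and `-c`. They
  -- annihilate each other, so the exponential splits. The coefficient of `Y` may stay unspecified,
  -- because the later applications only see traces in which `Y` contributes zero.
  · set P : Matrix n n ℂ := (2 : ℂ)⁻¹ • (R + c⁻¹ • Y) with hP
    set M : Matrix n n ℂ := (2 : ℂ)⁻¹ • (R - c⁻¹ • Y) with hM
    have hYY : (c⁻¹ • Y) * (c⁻¹ • Y) = R := by
      rw [smul_mul_smul_comm, hY, smul_smul]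
      field_simp
      simp
    have hRZ : R * (c⁻¹ • Y) = c⁻¹ • Y := by rw [mul_smul_comm, hRY]
    have hZR : (c⁻¹ • Y) * R = c⁻¹ • Y := by rw [smul_mul_assoc, hYR]
    have hPP : P * P = P := by
      rw [hP, smul_mul_smul_comm, add_mul, mul_add, mul_add, hR, hRZ, hZR, hYY]
      module
    have hMM : M * M = M := by
      rw [hM, smul_mul_smul_comm, sub_mul, mul_sub, mul_sub, hR, hRZ, hZR, hYY]
      module
    have hPM : P * M = 0 := by
      rw [hM, hP, smul_mul_smul_comm, add_mul, mul_sub, mul_sub, hR, hRZ, hZR, hYY]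
      module
    have hMP : M * P = 0 := by
      rw [hM, hP, smul_mul_smul_comm, sub_mul, mul_add, mul_add, hR, hRZ, hZR, hYY]
      module
    have hsum : t • R + Y = (t + c) • P + (t - c) • M := by
      have : Y = c • (c⁻¹ • Y) := by rw [smul_smul, mul_inv_cancel₀ hc, one_smul]
      rw [hP, hM]
      nth_rewrite 1 [this]
      module
    refine ⟨Complex.exp t * Complex.sinh c * c⁻¹, ?_⟩
    rw [hsum, exp_add_of_commute, exp_smul_of_idempotent _ hPP, exp_smul_of_idempotent _ hMM]
    · have : (1 + (Complex.exp (t + c) - 1) • P) * (1 + (Complex.exp (t - c) - 1) • M)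
          = 1 + (Complex.exp (t + c) - 1) • P + (Complex.exp (t - c) - 1) • M := by
        rw [add_mul, mul_add, mul_add, smul_mul_smul_comm, hPM]
        simp only [one_mul, mul_one, smul_zero, add_zero]
        abel
      rw [this, Complex.exp_add, sub_eq_add_neg t c, Complex.exp_add, Complex.cosh, Complex.sinh,
        hP, hM]
      module
    · rw [smul_mul_smul_comm (t + c) P, smul_mul_smul_comm (t - c) M, hPM, hMP]
      simp

/-- Cyclicity of the trace, for exponentials of products. -/
theorem trace_mul_exp_sub_trace {U V X Y : Matrix n n ℂ} (h : Y * V = U * Y) (b : ℂ) :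
    (V * NormedSpace.exp (b • (X * Y))).trace - V.trace
      = (U * NormedSpace.exp (b • (Y * X))).trace - U.trace := by
  have key : ∀ A B : Matrix n n ℂ,
      HasSum (fun k : ℕ => (((k + 1)! : ℂ)⁻¹ * b ^ (k + 1)) * (A * B ^ (k + 1)).trace)
        ((A * NormedSpace.exp (b • B)).trace - A.trace) := by
    intro A B
    have h1 := hasSum_matrix_exp (b • B)
    let f : Matrix n n ℂ →ₗ[ℂ] ℂ := (Matrix.traceLinearMap n ℂ ℂ).comp (LinearMap.mulLeft ℂ A)
    have hf : Continuous f := LinearMap.continuous_of_finiteDimensional f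
    have h2 : HasSum (fun k : ℕ => f (((k ! : ℂ)⁻¹) • (b • B) ^ k))
      (f (NormedSpace.exp (b • B))) := h1.map f.toAddMonoidHom hf
    -- The zeroth term is removed: only positive powers of `X * Y` contain a factor `Y` that can be
    -- moved around the trace.
    have h3 := (hasSum_nat_add_iff' 1).2 h2
    have hfv : ∀ M, f M = (A * M).trace := fun M => rfl
    simpa [hfv, smul_pow, smul_smul] using h3
  have h1 := key V (X * Y)
  have h2 := key U (Y * X)
  have : (fun k : ℕ => (((k + 1)! : ℂ)⁻¹ * b ^ (k + 1)) * (V * (X * Y) ^ (k + 1)).trace)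
      = fun k : ℕ => (((k + 1)! : ℂ)⁻¹ * b ^ (k + 1)) * (U * (Y * X) ^ (k + 1)).trace := by
    funext k
    congr 1
    have hc : X * (Y * X) ^ k = (X * Y) ^ k * X := by
      induction k with
      | zero => simp
      | succ k ih =>
        rw [pow_succ, ← mul_assoc, ih, pow_succ]
        simp only [mul_assoc]
    calc (V * (X * Y) ^ (k + 1)).trace
        = ((V * X * (Y * X) ^ k) * Y).trace := by
          rw [pow_succ, mul_assoc V X, hc]
          simp only [mul_assoc]
      _ = (Y * (V * X * (Y * X) ^ k)).trace := Matrix.trace_mul_comm _ _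
      _ = (U * (Y * X) ^ (k + 1)).trace := by
          rw [pow_succ', ← mul_assoc, ← mul_assoc, h]
          simp only [mul_assoc]
  rw [this] at h1
  exact h1.unique h2

theorem trace_exp_eq_sum_exp_eigenvalues {A : Matrix n n ℂ} (hA : A.IsHermitian) :
    (NormedSpace.exp A).trace = ((∑ i, Real.exp (hA.eigenvalues i) : ℝ) : ℂ) := by
  have h := hA.spectral_theorem
  rw [Unitary.conjStarAlgAut_apply] at h
  set U := hA.eigenvectorUnitary
  have hU : ((U : Matrix n n ℂ)) * (star U : Matrix n n ℂ) = 1 := Unitary.coe_mul_star_self U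
  have hU' : (star (U : Matrix n n ℂ)) = (U : Matrix n n ℂ)⁻¹ := by
    exact (Matrix.inv_eq_right_inv hU).symm
  have hu : IsUnit (U : Matrix n n ℂ) := by
    exact IsUnit.of_mul_eq_one _ hU
  have e : (NormedSpace.exp A).trace = (NormedSpace.exp ((U : Matrix n n ℂ) *
      Matrix.diagonal (RCLike.ofReal ∘ hA.eigenvalues) * star (U : Matrix n n ℂ))).trace :=
    congrArg (fun Z => (NormedSpace.exp Z).trace) h
  rw [e, hU', Matrix.exp_conj _ _ hu, Matrix.exp_diagonal, Matrix.trace_mul_comm, ← mul_assoc,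
    ← hU', Unitary.coe_star_mul_self, one_mul, Matrix.trace_diagonal]
  push_cast
  refine Finset.sum_congr rfl fun i _ => ?_
  rw [Pi.coe_exp, ← Complex.exp_eq_exp_ℂ]
  simp

/-- The exponential itself is not operator monotone, but its trace is. In an eigenbasis of `A`, each
eigenvalue of `A` is at most the diagonal entry of `B`, which averages the eigenvalues of `B` with
the doubly stochastic weights `‖W j i‖ ^ 2`; Jensen's inequality for `Real.exp` then gives the
bound. -/
theorem trace_exp_mono {A B : Matrix n n ℂ} (hA : A.IsHermitian) (hB : B.IsHermitian)
    (h : (B - A).PosSemidef) :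
    (NormedSpace.exp A).trace.re ≤ (NormedSpace.exp B).trace.re := by
  rw [trace_exp_eq_sum_exp_eigenvalues hA, trace_exp_eq_sum_exp_eigenvalues hB,
    Complex.ofReal_re, Complex.ofReal_re]
  set U : Matrix n n ℂ := hA.eigenvectorUnitary.1 with hU
  set V : Matrix n n ℂ := hB.eigenvectorUnitary.1 with hV
  set W : Matrix n n ℂ := Vᴴ * U with hW
  have hUU : Uᴴ * U = 1 := Unitary.coe_star_mul_self hA.eigenvectorUnitary
  have hUU' : U * Uᴴ = 1 := Unitary.coe_mul_star_self hA.eigenvectorUnitary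
  have hVV : Vᴴ * V = 1 := Unitary.coe_star_mul_self hB.eigenvectorUnitary
  have hVV' : V * Vᴴ = 1 := Unitary.coe_mul_star_self hB.eigenvectorUnitary
  have hWW : Wᴴ * W = 1 := by
    rw [hW, Matrix.conjTranspose_mul, Matrix.conjTranspose_conjTranspose, mul_assoc,
      ← mul_assoc V, hVV', one_mul, hUU]
  have hWW' : W * Wᴴ = 1 := by
    rw [hW, Matrix.conjTranspose_mul, Matrix.conjTranspose_conjTranspose, mul_assoc,
      ← mul_assoc U, hUU', one_mul, hVV]
  have hcol : ∀ i, ∑ j, ‖W j i‖ ^ 2 = 1 := by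
    intro i
    have := congrFun (congrFun hWW i) i
    simp only [Matrix.mul_apply, Matrix.conjTranspose_apply, Matrix.one_apply_eq] at this
    have h2 : ((∑ j, ‖W j i‖ ^ 2 : ℝ) : ℂ) = 1 := by
      rw [← this]
      push_cast
      refine Finset.sum_congr rfl fun j _ => ?_
      rw [← Complex.conj_mul']
      rfl
    exact_mod_cast h2
  have hrow : ∀ j, ∑ i, ‖W j i‖ ^ 2 = 1 := by
    intro j
    have := congrFun (congrFun hWW' j) j
    simp only [Matrix.mul_apply, Matrix.conjTranspose_apply, Matrix.one_apply_eq] at this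
    have h2 : ((∑ i, ‖W j i‖ ^ 2 : ℝ) : ℂ) = 1 := by
      rw [← this]
      push_cast
      refine Finset.sum_congr rfl fun i _ => ?_
      rw [← Complex.mul_conj']
      rfl
    exact_mod_cast h2
  have hAs : Uᴴ * A * U = Matrix.diagonal (fun i => (hA.eigenvalues i : ℂ)) := by
    have := hA.spectral_theorem
    rw [Unitary.conjStarAlgAut_apply] at this
    have e : Uᴴ * A * U = Uᴴ * (U * Matrix.diagonal (RCLike.ofReal ∘ hA.eigenvalues) * Uᴴ) * U :=
      congrArg (fun Z => Uᴴ * Z * U) this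
    rw [e]
    rw [← mul_assoc, ← mul_assoc, hUU, one_mul, mul_assoc, hUU, mul_one]
    rfl
  have hBs : Uᴴ * B * U = Wᴴ * Matrix.diagonal (fun i => (hB.eigenvalues i : ℂ)) * W := by
    have := hB.spectral_theorem
    rw [Unitary.conjStarAlgAut_apply] at this
    have e : Uᴴ * B * U = Uᴴ * (V * Matrix.diagonal (RCLike.ofReal ∘ hB.eigenvalues) * Vᴴ) * U :=
      congrArg (fun Z => Uᴴ * Z * U) this
    rw [e]
    rw [hW, Matrix.conjTranspose_mul, Matrix.conjTranspose_conjTranspose]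
    simp only [mul_assoc]
    rfl
  have hle : ∀ i, hA.eigenvalues i ≤ ∑ j, ‖W j i‖ ^ 2 * hB.eigenvalues j := by
    intro i
    have h1 := (h.conjTranspose_mul_mul_same U).diag_nonneg (i := i)
    rw [mul_sub, sub_mul, hAs, hBs] at h1
    simp only [Matrix.sub_apply, Matrix.diagonal_apply_eq, Matrix.mul_apply,
      Matrix.conjTranspose_apply] at h1
    have h2 : ∑ j, star (W j i) * (hB.eigenvalues j : ℂ) * W j i
        = ((∑ j, ‖W j i‖ ^ 2 * hB.eigenvalues j : ℝ) : ℂ) := by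
      push_cast
      refine Finset.sum_congr rfl fun j _ => ?_
      rw [← Complex.conj_mul']
      change (starRingEnd ℂ) (W j i) * _ * _ = _
      ring
    have h3 : (0 : ℂ) ≤ ((∑ j, ‖W j i‖ ^ 2 * hB.eigenvalues j - hA.eigenvalues i : ℝ) : ℂ) := by
      rw [Complex.ofReal_sub, ← h2]
      simpa [Matrix.mul_apply, Matrix.diagonal_apply] using h1
    have h4 := Complex.zero_le_real.1 h3
    linarith
  calc ∑ i, Real.exp (hA.eigenvalues i)
      ≤ ∑ i, ∑ j, ‖W j i‖ ^ 2 * Real.exp (hB.eigenvalues j) := by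
        refine Finset.sum_le_sum fun i _ => ?_
        refine (Real.exp_le_exp.2 (hle i)).trans ?_
        have := convexOn_exp.map_sum_le (t := Finset.univ) (w := fun j => ‖W j i‖ ^ 2)
          (p := fun j => hB.eigenvalues j) (fun _ _ => by positivity) (hcol i)
          (fun _ _ => Set.mem_univ _)
        simpa [smul_eq_mul] using this
    _ = ∑ j, Real.exp (hB.eigenvalues j) := by
        rw [Finset.sum_comm]
        refine Finset.sum_congr rfl fun j _ => ?_
        rw [← Finset.sum_mul, hrow j, one_mul]

end MatrixExp

/-! ### Tensor products of one-site operators -/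

section Tensor

set_option linter.unusedSectionVars false

open scoped Matrix

variable {X ι : Type} [Fintype X] [DecidableEq X] [Fintype ι] [DecidableEq ι]

/-- The tensor product of a family of one-site operators. -/
def piTensor (M : X → Matrix ι ι ℂ) : Matrix (X → ι) (X → ι) ℂ :=
  Matrix.of fun σ τ => ∏ x, M x (σ x) (τ x)

theorem piTensor_apply (M : X → Matrix ι ι ℂ) (σ τ : X → ι) :
    piTensor M σ τ = ∏ x, M x (σ x) (τ x) := rfl

theorem piTensor_mul (M N : X → Matrix ι ι ℂ) :
    piTensor M * piTensor N = piTensor (fun x => M x * N x) := by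
  ext σ τ
  simp only [Matrix.mul_apply, piTensor_apply, ← Finset.prod_mul_distrib]
  rw [Finset.prod_univ_sum]
  simp

theorem piTensor_one : piTensor (fun _ : X => (1 : Matrix ι ι ℂ)) = 1 := by
  ext σ τ
  rw [piTensor_apply]
  by_cases h : σ = τ
  · subst h
    rw [Matrix.one_apply_eq]
    exact Finset.prod_eq_one fun x _ => Matrix.one_apply_eq _
  · obtain ⟨x, hx⟩ := Function.ne_iff.1 h
    rw [Matrix.one_apply_ne h]
    exact Finset.prod_eq_zero (Finset.mem_univ x) (Matrix.one_apply_ne hx)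

theorem trace_piTensor (M : X → Matrix ι ι ℂ) : (piTensor M).trace = ∏ x, (M x).trace := by
  simp only [Matrix.trace, Matrix.diag, piTensor_apply]
  rw [Finset.prod_univ_sum]
  simp

/-- The one-site operator `A` acting on the site `x`. -/
def site (x : X) : Matrix ι ι ℂ →ₐ[ℂ] Matrix (X → ι) (X → ι) ℂ :=
  AlgHom.ofLinearMap
    { toFun := fun A => piTensor (fun y => if y = x then A else 1)
      map_add' := fun A B => by
        ext σ τ
        simp only [Matrix.add_apply, piTensor_apply]
        rw [← Finset.mul_prod_erase _ _ (Finset.mem_univ x),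
          ← Finset.mul_prod_erase Finset.univ (fun y => (if y = x then A else 1) (σ y) (τ y))
            (Finset.mem_univ x),
          ← Finset.mul_prod_erase Finset.univ (fun y => (if y = x then B else 1) (σ y) (τ y))
            (Finset.mem_univ x)]
        have : ∀ C : Matrix ι ι ℂ, ∏ y ∈ Finset.univ.erase x, (if y = x then C else 1) (σ y) (τ y)
            = ∏ y ∈ Finset.univ.erase x, (1 : Matrix ι ι ℂ) (σ y) (τ y) := fun C =>
          Finset.prod_congr rfl fun y hy => by rw [if_neg (Finset.ne_of_mem_erase hy)]
        rw [this, this, this]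
        simp [add_mul]
      map_smul' := fun c A => by
        ext σ τ
        simp only [Matrix.smul_apply, piTensor_apply, RingHom.id_apply]
        rw [← Finset.mul_prod_erase _ _ (Finset.mem_univ x),
          ← Finset.mul_prod_erase Finset.univ (fun y => (if y = x then A else 1) (σ y) (τ y))
            (Finset.mem_univ x)]
        have : ∀ C : Matrix ι ι ℂ, ∏ y ∈ Finset.univ.erase x, (if y = x then C else 1) (σ y) (τ y)
            = ∏ y ∈ Finset.univ.erase x, (1 : Matrix ι ι ℂ) (σ y) (τ y) := fun C =>
          Finset.prod_congr rfl fun y hy => by rw [if_neg (Finset.ne_of_mem_erase hy)]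
        rw [this, this]
        simp [mul_assoc] }
    (by simpa using piTensor_one)
    (fun A B => by
      change piTensor _ = piTensor _ * piTensor _
      rw [piTensor_mul]
      congr 1
      funext y
      split_ifs <;> simp)

theorem site_eq (x : X) (A : Matrix ι ι ℂ) :
    site x A = piTensor (fun y => if y = x then A else 1) := rfl

theorem site_apply (x : X) (A : Matrix ι ι ℂ) (σ τ : X → ι) :
    site x A σ τ = if ∀ y, y ≠ x → σ y = τ y then A (σ x) (τ x) else 0 := by
  rw [site_eq, piTensor_apply, ← Finset.mul_prod_erase _ _ (Finset.mem_univ x), if_pos rfl]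
  split_ifs with h
  · rw [Finset.prod_eq_one]
    · simp
    · intro y hy
      rw [if_neg (Finset.ne_of_mem_erase hy), h y (Finset.ne_of_mem_erase hy), Matrix.one_apply_eq]
  · push Not at h
    obtain ⟨y, hy, hne⟩ := h
    rw [Finset.prod_eq_zero (Finset.mem_erase.2 ⟨hy, Finset.mem_univ y⟩), mul_zero]
    rw [if_neg hy, Matrix.one_apply_ne hne]

theorem site_mul_site_comm {x y : X} (h : x ≠ y) (A B : Matrix ι ι ℂ) :
    site x A * site y B = site y B * site x A := by
  rw [site_eq, site_eq, piTensor_mul, piTensor_mul]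
  congr 1
  funext z
  by_cases h1 : z = x
  · have : z ≠ y := fun h2 => h (h1.symm.trans h2)
    simp [this]
  · simp [h1]

theorem conjTranspose_site (x : X) (A : Matrix ι ι ℂ) : (site x A)ᴴ = site x Aᴴ := by
  ext σ τ
  simp only [Matrix.conjTranspose_apply, site_apply]
  have : (∀ y, y ≠ x → τ y = σ y) ↔ ∀ y, y ≠ x → σ y = τ y :=
    forall_congr' fun y => imp_congr_right fun _ => eq_comm
  simp only [this]
  split_ifs <;> simp

theorem site_diagonal (x : X) (d : ι → ℂ) :
    site x (Matrix.diagonal d) = Matrix.diagonal (fun σ : X → ι => d (σ x)) := by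
  ext σ τ
  rw [site_apply]
  by_cases h : σ = τ
  · simp [h]
  · rw [Matrix.diagonal_apply_ne _ h]
    split_ifs with h1
    · refine Matrix.diagonal_apply_ne _ fun h2 => h (funext fun y => ?_)
      by_cases hy : y = x
      · rw [hy, h2]
      · exact h1 y hy
    · rfl

open scoped Matrix.Norms.Operator in
theorem exp_site (x : X) (A : Matrix ι ι ℂ) :
    NormedSpace.exp (site x A) = site x (NormedSpace.exp A) := by
  have hc : Continuous (site (X := X) (ι := ι) x) :=
    LinearMap.continuous_of_finiteDimensional (site (X := X) (ι := ι) x).toLinearMap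
  exact (NormedSpace.map_exp (site (X := X) (ι := ι) x) hc A).symm

/-- Operators on different sites commute, so the exponential of the sum is the product of the
one-site exponentials; its trace is therefore the partition function of independent sites. -/
theorem exp_sum_site (A : X → Matrix ι ι ℂ) :
    NormedSpace.exp (∑ x, site x (A x)) = piTensor (fun x => NormedSpace.exp (A x)) := by
  have key : ∀ s : Finset X, NormedSpace.exp (∑ x ∈ s, site x (A x))
      = piTensor (fun x => if x ∈ s then NormedSpace.exp (A x) else 1) := by
    intro s
    induction s using Finset.induction_on with
    | empty => simp [piTensor_one]
    | insert x s hx ih =>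
      rw [Finset.sum_insert hx, exp_add_of_commute, ih, exp_site, site_eq, piTensor_mul]
      · congr 1
        funext y
        by_cases hy : y = x
        · subst hy
          simp [hx]
        · simp [hy]
      · rw [Finset.mul_sum, Finset.sum_mul]
        exact Finset.sum_congr rfl fun y hy => site_mul_site_comm (fun h => hx (by rw [h]; exact hy)) _ _
  simpa using key Finset.univ

theorem trace_exp_sum_site (A : X → Matrix ι ι ℂ) :
    (NormedSpace.exp (∑ x, site x (A x))).trace = ∏ x, (NormedSpace.exp (A x)).trace := by
  rw [exp_sum_site, trace_piTensor]

end Tensor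

/-! ### The Jordan-Wigner transformation -/

section JordanWigner

set_option linter.unusedSectionVars false

open scoped Matrix

/-- Occupation numbers of the four states of a site: empty, up, down, doubly occupied. -/
def occ : Fin 4 → Spin → Bool :=
  ![![false, false], ![true, false], ![false, true], ![true, true]]

theorem occ_injective : Function.Injective occ := by decide

theorem occ_surjective : Function.Surjective occ := by decide

variable {X : Type} [LinearOrder X] [Fintype X]

/-- The occupation number basis, indexed by the states of the sites. -/
def confEquiv (X : Type) [LinearOrder X] [Fintype X] : (X → Fin 4) ≃ Finset (Mode X) :=
  Equiv.ofBijective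
    (fun σ => Finset.univ.filter fun k : Mode X => occ (σ (ofLex k).1) (ofLex k).2 = true) <| by
    constructor
    · intro σ τ h
      funext x
      apply occ_injective
      funext s
      have := Finset.ext_iff.1 h (toLex (x, s))
      simp only [Finset.mem_filter, Finset.mem_univ, true_and, ofLex_toLex] at this
      exact Bool.eq_iff_iff.2 this
    · intro S
      choose f hf using occ_surjective
      refine ⟨fun x => f fun s => decide (toLex (x, s) ∈ S), ?_⟩
      ext k
      simp [hf]

theorem mem_confEquiv (σ : X → Fin 4) (x : X) (s : Spin) :
    toLex (x, s) ∈ confEquiv X σ ↔ occ (σ x) s = true := by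
  change toLex (x, s) ∈ Finset.univ.filter _ ↔ _
  simp only [Finset.mem_filter, Finset.mem_univ, true_and, ofLex_toLex]

/-- Operators on the Fock space as matrices indexed by the states of the sites. -/
def toConf (X : Type) [LinearOrder X] [Fintype X] :
    FockOp X ≃ₐ[ℂ] Matrix (X → Fin 4) (X → Fin 4) ℂ :=
  Matrix.reindexAlgEquiv ℂ ℂ (confEquiv X).symm

theorem toConf_apply (A : FockOp X) (σ τ : X → Fin 4) :
    toConf X A σ τ = A (confEquiv X σ) (confEquiv X τ) := rfl

theorem toConf_conjTranspose (A : FockOp X) : toConf X Aᴴ = (toConf X A)ᴴ := rfl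

theorem trace_toConf (A : FockOp X) : (toConf X A).trace = A.trace := by
  simp only [Matrix.trace, Matrix.diag, toConf_apply]
  exact (confEquiv X).sum_comp fun S => A S S

open scoped Matrix.Norms.Operator in
theorem toConf_exp (A : FockOp X) :
    toConf X (NormedSpace.exp A) = NormedSpace.exp (toConf X A) := by
  have hc : Continuous (toConf X) :=
    LinearMap.continuous_of_finiteDimensional (toConf X).toLinearMap
  exact NormedSpace.map_exp (toConf X) hc A

theorem logPartition_eq (β : ℝ) (H : FockOp X) :
    logPartition β H = Real.log (NormedSpace.exp (toConf X (-(β : ℂ) • H))).trace.re := by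
  rw [logPartition, ← toConf_exp, trace_toConf]

/-- The parity operator of a site. -/
def parity : Matrix (Fin 4) (Fin 4) ℂ :=
  Matrix.of fun i j => if i = j then ∏ s, (if occ j s = true then -1 else 1) else 0

/-- The annihilation operators of a site. -/
def siteAnn (s : Spin) : Matrix (Fin 4) (Fin 4) ℂ :=
  Matrix.of fun i j =>
    if occ j s = true ∧ ∀ r, (occ i r = true ↔ r ≠ s ∧ occ j r = true) then
      ∏ r, (if occ j r = true ∧ r < s then -1 else 1) else 0

/-- In the lexicographic order all modes of earlier sites precede `(x, s)` and all modes of later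
sites follow it. The fermionic sign therefore factors into a parity for each site before `x`, a sign
inside the site `x`, and nothing after it. -/
theorem toConf_ann (x : X) (s : Spin) :
    toConf X (ann x s)
      = piTensor (fun y => if y < x then parity else if y = x then siteAnn s else 1) := by
  ext σ τ
  rw [toConf_apply, piTensor_apply, ann, Matrix.of_apply]
  have hsign : (-1 : ℂ) ^ ((confEquiv X τ).filter (fun k => k < toLex (x, s))).card
      = ∏ y, ∏ r, (if occ (τ y) r = true ∧ toLex (y, r) < toLex (x, s) then -1 else 1) := by
    have hS : confEquiv X τ
        = Finset.univ.filter fun k : Mode X => occ (τ (ofLex k).1) (ofLex k).2 = true := rfl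
    rw [← Finset.prod_const, hS, Finset.filter_filter, Finset.prod_filter,
      ← Fintype.prod_prod_type',
      ← Equiv.prod_comp (toLex : X × Spin ≃ Mode X)]
    rfl
  have hcond : (toLex (x, s) ∈ confEquiv X τ ∧ confEquiv X σ = (confEquiv X τ).erase (toLex (x, s)))
      ↔ ∀ y, (if y = x then occ (τ y) s = true ∧
          ∀ r, (occ (σ y) r = true ↔ r ≠ s ∧ occ (τ y) r = true) else σ y = τ y) := by
    rw [mem_confEquiv]
    constructor
    · rintro ⟨h1, h2⟩ y
      have h3 : ∀ r, (occ (σ y) r = true ↔ toLex (y, r) ≠ toLex (x, s) ∧ occ (τ y) r = true) := by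
        intro r
        rw [← mem_confEquiv, h2, Finset.mem_erase, mem_confEquiv]
      split_ifs with hy
      · subst hy
        exact ⟨h1, fun r => by simpa using h3 r⟩
      · refine occ_injective (funext fun r => ?_)
        rw [Bool.eq_iff_iff, h3]
        simp [hy]
    · intro h
      have hx := h x
      rw [if_pos rfl] at hx
      refine ⟨hx.1, ?_⟩
      ext k
      obtain ⟨⟨y, r⟩, rfl⟩ := toLex.surjective k
      rw [Finset.mem_erase, mem_confEquiv, mem_confEquiv]
      have hy := h y
      split_ifs at hy with hyx
      · subst hyx
        simpa using hy.2 r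
      · rw [hy]
        simp [hyx]
  rw [hsign]
  by_cases hc : toLex (x, s) ∈ confEquiv X τ ∧ confEquiv X σ = (confEquiv X τ).erase (toLex (x, s))
  · rw [if_pos hc]
    rw [hcond] at hc
    refine Finset.prod_congr rfl fun y _ => ?_
    have hy := hc y
    rcases lt_trichotomy y x with h | h | h
    · rw [if_neg h.ne] at hy
      simp [h, hy, parity, Prod.Lex.toLex_lt_toLex]
    · subst h
      rw [if_pos rfl] at hy
      simp only [lt_irrefl, if_false, if_true, siteAnn, Matrix.of_apply, if_pos hy]
      simp [Prod.Lex.toLex_lt_toLex]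
    · rw [if_neg h.ne'] at hy
      rw [hy, if_neg h.not_gt, if_neg h.ne', Matrix.one_apply_eq]
      simp [h.not_gt, h.ne', Prod.Lex.toLex_lt_toLex]
  · rw [if_neg hc]
    rw [hcond] at hc
    push Not at hc
    obtain ⟨y, hy⟩ := hc
    symm
    refine Finset.prod_eq_zero (Finset.mem_univ y) ?_
    rcases lt_trichotomy y x with h | h | h
    · rw [if_neg h.ne] at hy
      simp [h, hy, parity]
    · rw [if_pos h] at hy
      rw [if_neg (by simp [h]), if_pos h, siteAnn, Matrix.of_apply, if_neg hy]
    · rw [if_neg h.ne'] at hy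
      rw [if_neg h.not_gt, if_neg h.ne', Matrix.one_apply_ne hy]

theorem siteAnn_up : siteAnn up = !![0, 1, 0, 0; 0, 0, 0, 0; 0, 0, 0, 1; 0, 0, 0, 0] := by
  ext i j
  fin_cases i <;> fin_cases j <;> simp [siteAnn, occ, up, Fin.forall_fin_two]

/-- The entry `-1` is the sign for passing the occupied up mode, which precedes the down mode. -/
theorem siteAnn_dn : siteAnn dn = !![0, 0, 1, 0; 0, 0, 0, -1; 0, 0, 0, 0; 0, 0, 0, 0] := by
  ext i j
  fin_cases i <;> fin_cases j <;> simp [siteAnn, occ, dn, Fin.forall_fin_two]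

theorem parity_mul_parity : parity * parity = 1 := by
  have : parity = Matrix.diagonal fun j => ∏ s, (if occ j s = true then -1 else 1) := by
    ext i j
    simp [parity, Matrix.diagonal_apply]
    grind
  rw [this, Matrix.diagonal_mul_diagonal, ← Matrix.diagonal_one]
  congr 1
  funext j
  rw [← Finset.prod_mul_distrib]
  refine Finset.prod_eq_one fun s _ => ?_
  split_ifs <;> simp

theorem conjTranspose_parity : parityᴴ = parity := by
  ext i j
  fin_cases i <;> fin_cases j <;> simp [parity, occ]

theorem conjTranspose_piTensor {ι : Type} [Fintype ι] (M : X → Matrix ι ι ℂ) :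
    (piTensor M)ᴴ = piTensor (fun x => (M x)ᴴ) := by
  ext σ τ
  simp [piTensor_apply]

theorem toConf_cre (x : X) (s : Spin) :
    toConf X (cre x s)
      = piTensor (fun y => if y < x then parity else if y = x then (siteAnn s)ᴴ else 1) := by
  rw [cre, toConf_conjTranspose, toConf_ann, conjTranspose_piTensor]
  congr 1
  funext y
  split_ifs <;> simp [conjTranspose_parity]

/-- The parity strings square to the identity, so a product of two fermion operators at one site is
strictly local. Every term of the Hamiltonian is built from such pairs. -/
theorem piTensor_jordanWigner_mul (x : X) (A B : Matrix (Fin 4) (Fin 4) ℂ) :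
    piTensor (fun y => if y < x then parity else if y = x then A else 1)
      * piTensor (fun y => if y < x then parity else if y = x then B else 1) = site x (A * B) := by
  rw [piTensor_mul, site_eq]
  congr 1
  funext y
  rcases lt_trichotomy y x with h | h | h
  · simp [h, h.ne, parity_mul_parity]
  · simp [h]
  · simp [h.not_gt, h.ne']

theorem toConf_cre_mul_ann (x : X) (s t : Spin) :
    toConf X (cre x s * ann x t) = site x ((siteAnn s)ᴴ * siteAnn t) := by
  rw [map_mul, toConf_cre, toConf_ann, piTensor_jordanWigner_mul]

theorem toConf_ann_mul_ann (x : X) (s t : Spin) :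
    toConf X (ann x s * ann x t) = site x (siteAnn s * siteAnn t) := by
  rw [map_mul, toConf_ann, toConf_ann, piTensor_jordanWigner_mul]

end JordanWigner

/-! ### One-site operators -/

section OneSite

open scoped Matrix

/-- The pair annihilation operator of a site. -/
def pairLower : Matrix (Fin 4) (Fin 4) ℂ := !![0, 0, 0, 1; 0, 0, 0, 0; 0, 0, 0, 0; 0, 0, 0, 0]

/-- The pair creation operator of a site. -/
def pairRaise : Matrix (Fin 4) (Fin 4) ℂ := !![0, 0, 0, 0; 0, 0, 0, 0; 0, 0, 0, 0; 1, 0, 0, 0]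

/-- The projection onto singly occupied states. -/
def singleProj : Matrix (Fin 4) (Fin 4) ℂ := Matrix.diagonal ![0, 1, 1, 0]

/-- The projection onto the doubly occupied state. -/
def doubleProj : Matrix (Fin 4) (Fin 4) ℂ := Matrix.diagonal ![0, 0, 0, 1]

/-- The projection onto empty and doubly occupied states. -/
def pairedProj : Matrix (Fin 4) (Fin 4) ℂ := Matrix.diagonal ![1, 0, 0, 1]

/-- The energy `b · M` of a site in the magnetic induction `b`. -/
def fieldMat (th : ℝ) (b : E3) : Matrix (Fin 4) (Fin 4) ℂ :=
  !![0, 0, 0, 0;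
     0, th * b 2, th * (b 0 - Complex.I * b 1), 0;
     0, th * (b 0 + Complex.I * b 1), -(th * b 2), 0;
     0, 0, 0, 0]

/-- The traceless part of the one-site approximating Hamiltonian on empty and doubly occupied
states. -/
def gapMat (u v : ℝ) : Matrix (Fin 4) (Fin 4) ℂ :=
  !![-(u : ℂ), 0, 0, v; 0, 0, 0, 0; 0, 0, 0, 0; v, 0, 0, u]

variable {X : Type} [LinearOrder X] [Fintype X]

theorem conjTranspose_pairLower : pairLowerᴴ = pairRaise := by
  ext i j
  fin_cases i <;> fin_cases j <;> simp [pairLower, pairRaise]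

theorem toConf_num (x : X) (s : Spin) :
    toConf X (num x s) = site x ((siteAnn s)ᴴ * siteAnn s) := toConf_cre_mul_ann x s s

theorem toConf_num_add_num (x : X) :
    toConf X (num x up + num x dn) = site x (singleProj + (2 : ℂ) • doubleProj) := by
  rw [map_add, toConf_num, toConf_num, ← map_add, siteAnn_up, siteAnn_dn]
  congr 1
  ext i j
  fin_cases i <;> fin_cases j <;>
    simp [singleProj, doubleProj, Matrix.mul_apply, Fin.sum_univ_four, one_add_one_eq_two]

theorem toConf_num_mul_num (x : X) : toConf X (num x up * num x dn) = site x doubleProj := by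
  rw [map_mul, toConf_num, toConf_num, ← map_mul, siteAnn_up, siteAnn_dn]
  congr 1
  ext i j
  fin_cases i <;> fin_cases j <;> simp [doubleProj, Matrix.mul_apply, Fin.sum_univ_four]

theorem toConf_pair_ann (x : X) : toConf X (ann x dn * ann x up) = site x pairLower := by
  rw [toConf_ann_mul_ann, siteAnn_up, siteAnn_dn]
  congr 1
  ext i j
  fin_cases i <;> fin_cases j <;> simp [pairLower, Matrix.mul_apply, Fin.sum_univ_four]

theorem toConf_pair_cre (x : X) : toConf X (cre x up * cre x dn) = site x pairRaise := by
  rw [← conjTranspose_pairLower, ← conjTranspose_site, ← toConf_pair_ann, ← toConf_conjTranspose,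
    Matrix.conjTranspose_mul, cre, cre]

theorem toConf_magn (th : ℝ) (x : X) (b : E3) :
    toConf X (∑ j : Fin 3, (b j : ℂ) • magn th x j) = site x (fieldMat th b) := by
  simp only [Fin.sum_univ_three, map_add, map_smul, magn, Matrix.cons_val, map_sub, toConf_num,
    toConf_cre_mul_ann]
  simp only [← map_add, ← map_sub, ← map_smul, siteAnn_up, siteAnn_dn]
  congr 1
  ext i j
  fin_cases i <;> fin_cases j <;>
    simp [fieldMat, Matrix.mul_apply, Fin.sum_univ_four] <;> ring

theorem singleProj_mul_self : singleProj * singleProj = singleProj := by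
  rw [singleProj, Matrix.diagonal_mul_diagonal]
  congr 1
  ext i
  fin_cases i <;> simp

theorem pairedProj_mul_self : pairedProj * pairedProj = pairedProj := by
  rw [pairedProj, Matrix.diagonal_mul_diagonal]
  congr 1
  ext i
  fin_cases i <;> simp

theorem singleProj_mul_fieldMat (th : ℝ) (b : E3) : singleProj * fieldMat th b = fieldMat th b := by
  ext i j
  rw [singleProj, Matrix.diagonal_mul]
  fin_cases i <;> fin_cases j <;> simp [fieldMat]

theorem fieldMat_mul_singleProj (th : ℝ) (b : E3) : fieldMat th b * singleProj = fieldMat th b := by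
  ext i j
  rw [singleProj, Matrix.mul_diagonal]
  fin_cases i <;> fin_cases j <;> simp [fieldMat]

/-- The Pauli relation `(b · σ)² = ‖b‖²`: only the length of the field enters the spectrum. -/
theorem fieldMat_mul_self (th : ℝ) (b : E3) :
    fieldMat th b * fieldMat th b = ((th * ‖b‖ : ℝ) : ℂ) ^ 2 • singleProj := by
  have hb : ((‖b‖ : ℝ) : ℂ) ^ 2 = (b 0 : ℂ) ^ 2 + (b 1 : ℂ) ^ 2 + (b 2 : ℂ) ^ 2 := by
    have := EuclideanSpace.real_norm_sq_eq b
    rw [Fin.sum_univ_three] at this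
    exact_mod_cast this
  have h2 : ((th * ‖b‖ : ℝ) : ℂ) ^ 2
      = (th : ℂ) ^ 2 * ((b 0 : ℂ) ^ 2 + (b 1 : ℂ) ^ 2 + (b 2 : ℂ) ^ 2) := by
    rw [← hb]
    push_cast
    ring
  rw [h2]
  ext i j
  fin_cases i <;> fin_cases j <;>
    simp [fieldMat, singleProj, Matrix.mul_apply, Fin.sum_univ_four] <;>
    ring_nf <;> simp [Complex.I_sq]

theorem pairedProj_mul_gapMat (u v : ℝ) : pairedProj * gapMat u v = gapMat u v := by
  ext i j
  rw [pairedProj, Matrix.diagonal_mul]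
  fin_cases i <;> fin_cases j <;> simp [gapMat]

theorem gapMat_mul_pairedProj (u v : ℝ) : gapMat u v * pairedProj = gapMat u v := by
  ext i j
  rw [pairedProj, Matrix.mul_diagonal]
  fin_cases i <;> fin_cases j <;> simp [gapMat]

theorem gapMat_mul_self (u v : ℝ) :
    gapMat u v * gapMat u v = ((√(u ^ 2 + v ^ 2) : ℝ) : ℂ) ^ 2 • pairedProj := by
  have h : ((√(u ^ 2 + v ^ 2) : ℝ) : ℂ) ^ 2 = (u : ℂ) ^ 2 + (v : ℂ) ^ 2 := by
    have := Real.sq_sqrt (by positivity : 0 ≤ u ^ 2 + v ^ 2)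
    exact_mod_cast this
  rw [h]
  ext i j
  fin_cases i <;> fin_cases j <;>
    simp [gapMat, pairedProj, Matrix.mul_apply, Fin.sum_univ_four] <;> ring

theorem singleProj_mul_pairedProj : singleProj * pairedProj = 0 := by
  rw [singleProj, pairedProj, Matrix.diagonal_mul_diagonal, ← Matrix.diagonal_zero]
  congr 1
  ext i
  fin_cases i <;> simp

theorem pairedProj_mul_singleProj : pairedProj * singleProj = 0 := by
  rw [singleProj, pairedProj, Matrix.diagonal_mul_diagonal, ← Matrix.diagonal_zero]
  congr 1
  ext i
  fin_cases i <;> simp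

theorem isHermitian_singleProj : singleProj.IsHermitian := by
  ext i j
  fin_cases i <;> fin_cases j <;> simp [singleProj]

theorem isHermitian_pairedProj : pairedProj.IsHermitian := by
  ext i j
  fin_cases i <;> fin_cases j <;> simp [pairedProj]

theorem isHermitian_doubleProj : doubleProj.IsHermitian := by
  ext i j
  fin_cases i <;> fin_cases j <;> simp [doubleProj]

theorem isHermitian_fieldMat (th : ℝ) (b : E3) : (fieldMat th b).IsHermitian := by
  ext i j
  fin_cases i <;> fin_cases j <;> simp [fieldMat, sub_eq_add_neg]

theorem isHermitian_gapMat (u v : ℝ) : (gapMat u v).IsHermitian := by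
  ext i j
  fin_cases i <;> fin_cases j <;> simp [gapMat]

/-- Minus the inverse temperature times the energy of a site that is not paired. -/
def singleExponent (β μ th : ℝ) (b : E3) : Matrix (Fin 4) (Fin 4) ℂ :=
  ((β * μ : ℝ) : ℂ) • singleProj + fieldMat (β * th) b

/-- The partition function of the singly occupied states of a site. -/
def singleWeight (β μ th : ℝ) (b : E3) : ℝ := 2 * Real.exp (β * μ) * Real.cosh (β * th * ‖b‖)

/-- The partition function of the empty and doubly occupied states of a site. -/
def pairWeight (β μ lam γ r : ℝ) : ℝ :=
  2 * Real.exp (β * (μ - lam)) * Real.cosh (√((β * (μ - lam)) ^ 2 + (β * γ * √r) ^ 2))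

theorem exp_singleExponent (β μ th : ℝ) (b : E3) : ∃ s : ℂ,
    NormedSpace.exp (singleExponent β μ th b)
      = 1 + ((Real.exp (β * μ) * Real.cosh (β * th * ‖b‖) - 1 : ℝ) : ℂ) • singleProj
        + s • fieldMat (β * th) b := by
  obtain ⟨s, hs⟩ := exists_exp_smul_add_eq ((β * μ : ℝ) : ℂ) ((β * th * ‖b‖ : ℝ) : ℂ)
    singleProj_mul_self (singleProj_mul_fieldMat (β * th) b) (fieldMat_mul_singleProj (β * th) b)
    (fieldMat_mul_self (β * th) b) (fun h => by
      have h : β * th * ‖b‖ = 0 := by exact_mod_cast h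
      rcases mul_eq_zero.1 h with h | h
      · ext i j
        rw [h]
        fin_cases i <;> fin_cases j <;> simp [fieldMat]
      · rw [norm_eq_zero] at h
        ext i j
        rw [h]
        fin_cases i <;> fin_cases j <;> simp [fieldMat])
  refine ⟨s, ?_⟩
  rw [singleExponent, hs]
  push_cast
  rfl

/-- The singly occupied and the paired states are orthogonal invariant subspaces, each carrying a
multiple of the identity plus a traceless two-level matrix with opposite eigenvalues; this gives one
`cosh` for each. -/
theorem trace_exp_oneSite (β μ lam γ th r : ℝ) (b : E3) :
    (NormedSpace.exp (singleExponent β μ th b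
      + (((β * (μ - lam) : ℝ) : ℂ) • pairedProj
        + gapMat (β * (μ - lam)) (β * γ * √r)))).trace
      = ((singleWeight β μ th b + pairWeight β μ lam γ r : ℝ) : ℂ) := by
  set u := β * (μ - lam)
  set v := β * γ * √r
  obtain ⟨s, hs⟩ := exp_singleExponent β μ th b
  obtain ⟨s', hs'⟩ := exists_exp_smul_add_eq (u : ℂ) ((√(u ^ 2 + v ^ 2) : ℝ) : ℂ)
    pairedProj_mul_self (pairedProj_mul_gapMat u v) (gapMat_mul_pairedProj u v)
    (gapMat_mul_self u v) (fun h => by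
      have h : √(u ^ 2 + v ^ 2) = 0 := by exact_mod_cast h
      rw [Real.sqrt_eq_zero (by positivity)] at h
      have hu : u = 0 := by nlinarith [sq_nonneg u, sq_nonneg v]
      have hv : v = 0 := by nlinarith [sq_nonneg u, sq_nonneg v]
      ext i j
      rw [hu, hv]
      fin_cases i <;> fin_cases j <;> simp [gapMat])
  have hFR : fieldMat (β * th) b * pairedProj = 0 := by
    rw [← fieldMat_mul_singleProj, mul_assoc, singleProj_mul_pairedProj, mul_zero]
  have hRF : pairedProj * fieldMat (β * th) b = 0 := by
    rw [← singleProj_mul_fieldMat, ← mul_assoc, pairedProj_mul_singleProj, zero_mul]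
  have hFG : fieldMat (β * th) b * gapMat u v = 0 := by
    rw [← pairedProj_mul_gapMat, ← mul_assoc, hFR, zero_mul]
  have hGF : gapMat u v * fieldMat (β * th) b = 0 := by
    rw [← gapMat_mul_pairedProj, mul_assoc, hRF, mul_zero]
  have hQG : singleProj * gapMat u v = 0 := by
    rw [← pairedProj_mul_gapMat, ← mul_assoc, singleProj_mul_pairedProj, zero_mul]
  have hGQ : gapMat u v * singleProj = 0 := by
    rw [← gapMat_mul_pairedProj, mul_assoc, pairedProj_mul_singleProj, mul_zero]
  rw [exp_add_of_commute, hs, hs']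
  · simp only [add_mul, mul_add, smul_mul_assoc, mul_smul_comm, hFR, hFG, hQG,
      singleProj_mul_pairedProj, one_mul, mul_one, smul_zero, add_zero, Matrix.trace_add,
      Matrix.trace_smul]
    have h1 : (1 : Matrix (Fin 4) (Fin 4) ℂ).trace = 4 := by simp
    have h2 : singleProj.trace = 2 := by
      simp [singleProj, Fin.sum_univ_four, one_add_one_eq_two]
    have h3 : pairedProj.trace = 2 := by
      simp [pairedProj, Fin.sum_univ_four, one_add_one_eq_two]
    have h4 : (fieldMat (β * th) b).trace = 0 := by
      simp [fieldMat, Matrix.trace, Fin.sum_univ_four]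
    have h5 : (gapMat u v).trace = 0 := by
      simp [gapMat, Matrix.trace, Fin.sum_univ_four]
    rw [h1, h2, h3, h4, h5, singleWeight, show pairWeight β μ lam γ r
      = 2 * Real.exp u * Real.cosh (√(u ^ 2 + v ^ 2)) from rfl]
    push_cast
    simp only [smul_eq_mul]
    ring
  · simp only [singleExponent, add_mul, mul_add, smul_mul_assoc, mul_smul_comm, hFR, hFG, hQG,
      hRF, hGF, hGQ, singleProj_mul_pairedProj, pairedProj_mul_singleProj, smul_zero, add_zero]

/-- Without pairing, the exponent is `0` on the empty state and `2 β (μ - lam)` on the doubly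
occupied one. Their mean `β (μ - lam)` multiplies `pairedProj`, and the deviations from it are the
diagonal of `gapMat`. -/
theorem toConf_oneSite (β μ lam γ th r : ℝ) (b : E3) (x : X) :
    toConf X (-(β : ℂ) • (-(μ : ℂ) • (num x up + num x dn)
      + (2 * (lam : ℂ)) • (num x up * num x dn)
      - ((γ * √r : ℝ) : ℂ) • (cre x up * cre x dn + ann x dn * ann x up)
      - ∑ j : Fin 3, (b j : ℂ) • magn th x j))
      = site x (singleExponent β μ th b
      + (((β * (μ - lam) : ℝ) : ℂ) • pairedProj
        + gapMat (β * (μ - lam)) (β * γ * √r))) := by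
  rw [map_smul, map_sub, map_sub, map_add, map_smul, map_smul, map_smul, toConf_magn,
    toConf_num_add_num, toConf_num_mul_num,
    map_add (toConf X) (cre x up * cre x dn), toConf_pair_cre, toConf_pair_ann]
  simp only [← map_add, ← map_smul, ← map_sub]
  congr 1
  ext i j
  fin_cases i <;> fin_cases j <;>
    simp [singleExponent, fieldMat, gapMat, singleProj, doubleProj, pairedProj, pairLower,
      pairRaise] <;> ring

theorem logPartition_site [Subsingleton X] (β μ lam γ th r : ℝ) (b : E3) (x : X) :
    logPartition β (-(μ : ℂ) • (num x up + num x dn)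
      + (2 * (lam : ℂ)) • (num x up * num x dn)
      - ((γ * √r : ℝ) : ℂ) • (cre x up * cre x dn + ann x dn * ann x up)
      - ∑ j : Fin 3, (b j : ℂ) • magn th x j)
      = Real.log (singleWeight β μ th b + pairWeight β μ lam γ r) := by
  set A := singleExponent β μ th b
      + (((β * (μ - lam) : ℝ) : ℂ) • pairedProj + gapMat (β * (μ - lam)) (β * γ * √r)) with hA
  have h1 : ∑ y : X, site y A = site x A :=
    Fintype.sum_subsingleton (fun y => site y A) x
  have h2 : ∏ y : X, (NormedSpace.exp A).trace = (NormedSpace.exp A).trace :=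
    Fintype.prod_subsingleton (fun _ => (NormedSpace.exp A).trace) x
  rw [logPartition_eq, toConf_oneSite, ← hA, ← h1, trace_exp_sum_site (fun _ : X => A), h2, hA,
    trace_exp_oneSite, Complex.ofReal_re]

theorem logPartition_oneSite (β μ lam γ th r : ℝ) (b : E3) :
    logPartition β (oneSite μ lam γ th r b)
      = Real.log (singleWeight β μ th b + pairWeight β μ lam γ r) :=
  logPartition_site β μ lam γ th r b ()

end OneSite

/-! ### The Hamiltonian in the basis of site states -/

section Hamiltonian

open scoped Matrix ComplexOrder

variable {X : Type} [LinearOrder X] [Fintype X]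

/-- The annihilation operator of a pair with zero momentum. -/
def lower (X : Type) [LinearOrder X] [Fintype X] : Matrix (X → Fin 4) (X → Fin 4) ℂ :=
  ∑ x, site x pairLower

/-- The creation operator of a pair with zero momentum. -/
def raise (X : Type) [LinearOrder X] [Fintype X] : Matrix (X → Fin 4) (X → Fin 4) ℂ :=
  ∑ x, site x pairRaise

theorem conjTranspose_lower : (lower X)ᴴ = raise X := by
  rw [lower, Matrix.conjTranspose_sum, raise]
  simp [conjTranspose_site, conjTranspose_pairLower]

theorem conjTranspose_raise : (raise X)ᴴ = lower X := by
  rw [← conjTranspose_lower, Matrix.conjTranspose_conjTranspose]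

/-- The Hamiltonian in the magnetic inductions `b x`. -/
def fieldHamiltonian (μ lam γ th : ℝ) (b : X → E3) : FockOp X :=
  bcsHubbard X μ lam γ + -∑ x, ∑ j : Fin 3, (b x j : ℂ) • magn th x j

/-- Minus the inverse temperature times the Hamiltonian, in the basis of site states. -/
def exponent (β μ lam γ th : ℝ) (b : X → E3) : Matrix (X → Fin 4) (X → Fin 4) ℂ :=
  ∑ x, site x (singleExponent β μ th (b x))
    + ((2 * β * (μ - lam) : ℝ) : ℂ) • ∑ x : X, site x doubleProj
    + ((β * γ / Fintype.card X : ℝ) : ℂ) • (raise X * lower X)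

theorem toConf_fieldHamiltonian (β μ lam γ th : ℝ) (b : X → E3) :
    toConf X (-(β : ℂ) • fieldHamiltonian μ lam γ th b) = exponent β μ lam γ th b := by
  have h1 : toConf X (∑ x : X, ∑ y : X, cre x up * cre x dn * ann y dn * ann y up)
      = raise X * lower X := by
    rw [raise, lower, Finset.sum_mul_sum, map_sum]
    refine Finset.sum_congr rfl fun x _ => ?_
    rw [map_sum]
    refine Finset.sum_congr rfl fun y _ => ?_
    rw [mul_assoc (cre x up * cre x dn), map_mul, toConf_pair_cre, toConf_pair_ann]
  have h2 : ∀ x : X, site x (singleExponent β μ th (b x))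
      = ((β * μ : ℝ) : ℂ) • site x singleProj + (β : ℂ) • site x (fieldMat th (b x)) := by
    intro x
    rw [← map_smul, ← map_smul, ← map_add]
    congr 1
    rw [singleExponent]
    congr 1
    ext i j
    fin_cases i <;> fin_cases j <;> simp [fieldMat] <;> ring
  rw [fieldHamiltonian, bcsHubbard, exponent, map_smul, map_add, map_neg, map_sub, map_add,
    map_smul, map_smul, map_smul, h1, map_sum, map_sum, map_sum]
  simp only [toConf_num_add_num, toConf_num_mul_num, toConf_magn, h2]
  simp only [map_add, map_smul, Finset.sum_add_distrib, ← Finset.smul_sum]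
  push_cast
  module

/-- The partition function in the magnetic inductions `b x`. -/
def partitionFunction (β μ lam γ th : ℝ) (b : X → E3) : ℝ :=
  (NormedSpace.exp (exponent β μ lam γ th b)).trace.re

theorem logPartition_fieldHamiltonian (β μ lam γ th : ℝ) (b : X → E3) :
    logPartition β (fieldHamiltonian μ lam γ th b)
      = Real.log (partitionFunction β μ lam γ th b) := by
  rw [logPartition_eq, toConf_fieldHamiltonian, partitionFunction]

theorem isHermitian_site (x : X) {A : Matrix (Fin 4) (Fin 4) ℂ} (hA : A.IsHermitian) :
    (site x A).IsHermitian := by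
  rw [Matrix.IsHermitian, conjTranspose_site, hA.eq]

theorem isHermitian_sum {n ι : Type} {s : Finset ι} {A : ι → Matrix n n ℂ}
    (hA : ∀ i ∈ s, (A i).IsHermitian) : (∑ i ∈ s, A i).IsHermitian := by
  rw [Matrix.IsHermitian, Matrix.conjTranspose_sum]
  exact Finset.sum_congr rfl fun i hi => (hA i hi).eq

theorem isHermitian_real_smul {n : Type} {A : Matrix n n ℂ} (hA : A.IsHermitian) (c : ℝ) :
    ((c : ℂ) • A).IsHermitian := by
  rw [Matrix.IsHermitian, Matrix.conjTranspose_smul, hA.eq]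
  simp

theorem isHermitian_singleExponent (β μ th : ℝ) (b : E3) :
    (singleExponent β μ th b).IsHermitian :=
  (isHermitian_real_smul isHermitian_singleProj _).add (isHermitian_fieldMat _ _)

theorem isHermitian_exponent (β μ lam γ th : ℝ) (b : X → E3) :
    (exponent β μ lam γ th b).IsHermitian := by
  refine ((isHermitian_sum fun x _ => isHermitian_site x (isHermitian_singleExponent _ _ _ _)).add
    (isHermitian_real_smul
      (isHermitian_sum fun x _ => isHermitian_site x isHermitian_doubleProj) _)).add
    (isHermitian_real_smul ?_ _)
  rw [Matrix.IsHermitian, Matrix.conjTranspose_mul, conjTranspose_lower, conjTranspose_raise]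

/-- The lower bound on the partition function by the approximating Hamiltonians. -/
theorem le_partitionFunction [Nonempty X] {β γ : ℝ} (hβ : 0 < β) (hγ : 0 < γ) (μ lam th : ℝ)
    (b : X → E3) {r : ℝ} (hr : 0 ≤ r) :
    Real.exp (-(β * γ * r * Fintype.card X))
        * ∏ x, (singleWeight β μ th (b x) + pairWeight β μ lam γ r)
      ≤ partitionFunction β μ lam γ th b := by
  set N : ℝ := ((Fintype.card X : ℕ) : ℝ) with hN
  have hN0 : 0 < N := by
    rw [hN]
    exact_mod_cast Fintype.card_pos
  set A : X → Matrix (Fin 4) (Fin 4) ℂ := fun x => singleExponent β μ th (b x)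
      + (((β * (μ - lam) : ℝ) : ℂ) • pairedProj + gapMat (β * (μ - lam)) (β * γ * √r)) with hA
  set c : ℝ := -(β * γ * r * N) with hc
  have hAH : (∑ x, site x (A x)).IsHermitian :=
    isHermitian_sum fun x _ => isHermitian_site x
      ((isHermitian_singleExponent _ _ _ _).add
        ((isHermitian_real_smul isHermitian_pairedProj _).add (isHermitian_gapMat _ _)))
  have h1H : (1 : Matrix (X → Fin 4) (X → Fin 4) ℂ).IsHermitian := Matrix.isHermitian_one
  set K : Matrix (X → Fin 4) (X → Fin 4) ℂ := (c : ℂ) • 1 + ∑ x, site x (A x) with hK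
  have hKH : K.IsHermitian := (isHermitian_real_smul h1H c).add hAH
  have htr : (NormedSpace.exp K).trace.re
      = Real.exp c * ∏ x, (singleWeight β μ th (b x) + pairWeight β μ lam γ r) := by
    rw [hK, exp_add_of_commute, exp_smul_of_idempotent _ (one_mul 1)]
    · have : (1 : Matrix (X → Fin 4) (X → Fin 4) ℂ) + (Complex.exp c - 1) • 1
          = Complex.exp c • 1 := by module
      rw [this, smul_mul_assoc, one_mul, Matrix.trace_smul, trace_exp_sum_site, hA]
      simp only [trace_exp_oneSite]
      rw [← Complex.ofReal_prod, ← Complex.ofReal_exp, smul_eq_mul, ← Complex.ofReal_mul,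
        Complex.ofReal_re]
    · rw [smul_mul_assoc, mul_smul_comm, one_mul, mul_one]
  rw [← htr]
  refine trace_exp_mono hKH (isHermitian_exponent _ _ _ _ _ _) ?_
  -- Completing the square: `Gᴴ * G` is `raise * lower - N √r (raise + lower) + N² r`, and the
  -- factor `β γ / N` turns `N² r` into `-c`.
  set G : Matrix (X → Fin 4) (X → Fin 4) ℂ := lower X - ((N * √r : ℝ) : ℂ) • 1 with hG
  have hGG : exponent β μ lam γ th b - K = ((β * γ / N : ℝ) : ℂ) • (Gᴴ * G) := by
    have hsA : ∑ x, site x (A x) = ∑ x, site x (singleExponent β μ th (b x))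
        + ((2 * β * (μ - lam) : ℝ) : ℂ) • ∑ x : X, site x doubleProj
        + ((β * γ * √r : ℝ) : ℂ) • (raise X + lower X) := by
      rw [raise, lower, ← Finset.sum_add_distrib, Finset.smul_sum, Finset.smul_sum,
        ← Finset.sum_add_distrib, ← Finset.sum_add_distrib]
      refine Finset.sum_congr rfl fun x _ => ?_
      rw [← map_add, ← map_smul, ← map_smul, ← map_add, ← map_add]
      congr 1
      rw [hA]
      simp only [add_assoc]
      congr 1
      ext i j
      fin_cases i <;> fin_cases j <;>
        simp [gapMat, doubleProj, pairedProj, pairLower, pairRaise]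
      ring
    have hsq : ((√r : ℝ) : ℂ) * ((√r : ℝ) : ℂ) = (r : ℂ) := by
      exact_mod_cast Real.mul_self_sqrt hr
    have hGH : Gᴴ = raise X - ((N * √r : ℝ) : ℂ) • 1 := by
      rw [hG, Matrix.conjTranspose_sub, conjTranspose_lower, Matrix.conjTranspose_smul]
      simp
    have hNC : (N : ℂ) ≠ 0 := by exact_mod_cast hN0.ne'
    have e1 : ((β * γ / N : ℝ) : ℂ) * ((N * √r : ℝ) : ℂ) = ((β * γ * √r : ℝ) : ℂ) := by
      push_cast
      field_simp
    have e2 : ((β * γ / N : ℝ) : ℂ) * (((N * √r : ℝ) : ℂ) * ((N * √r : ℝ) : ℂ)) = -(c : ℂ) := by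
      rw [hc]
      push_cast
      rw [← hsq]
      field_simp
    rw [hGH, hG, hK, hsA, exponent, ← hN, sub_mul, mul_sub, mul_sub]
    simp only [smul_mul_assoc, mul_smul_comm, one_mul, mul_one]
    simp only [smul_sub, smul_smul, e1, e2]
    module
  rw [hGG]
  refine (Matrix.posSemidef_conjTranspose_mul_self G).smul ?_
  rw [Complex.zero_le_real]
  positivity

end Hamiltonian

/-! ### An exact formula for the partition function -/

section Sectors

set_option linter.unusedSectionVars false

open scoped Matrix

variable {X : Type} [LinearOrder X] [Fintype X]

/-! ### Commutation relations of the total quasi-spin, and the sectors. -/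

theorem sum_site_mul_sum_site (A B : X → Matrix (Fin 4) (Fin 4) ℂ) :
    (∑ x, site x (A x)) * ∑ x, site x (B x)
      = (∑ x, site x (B x)) * (∑ x, site x (A x)) + ∑ x, site x (A x * B x - B x * A x) := by
  have h : ∀ x y : X, site x (A x) * site y (B y) = site y (B y) * site x (A x)
      + if x = y then site x (A x * B x - B x * A x) else 0 := by
    intro x y
    split_ifs with hxy
    · subst hxy
      simp
    · rw [site_mul_site_comm hxy, add_zero]
  rw [Finset.sum_mul_sum, Finset.sum_mul_sum, Finset.sum_comm (f := fun x y =>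
    site x (B x) * site y (A y)), ← Finset.sum_add_distrib]
  refine Finset.sum_congr rfl fun x _ => ?_
  simp only [h, Finset.sum_add_distrib, Finset.sum_ite_eq, Finset.mem_univ, if_true]

/-- `A` raises the charge `K` by `c` and `B` lowers it by `c`, so the product conserves it. -/
theorem mul_comm_of_commutator {n : Type} [Fintype n] {K A B : Matrix n n ℂ} {c : ℂ}
    (hA : K * A = A * K + c • A) (hB : K * B = B * K + (-c) • B) :
    K * (A * B) = A * B * K := by
  rw [← mul_assoc, hA, add_mul, mul_assoc, hB, mul_add, smul_mul_assoc, mul_smul_comm, mul_assoc]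
  module

open scoped Matrix.Norms.Operator in
theorem mul_exp_comm {n : Type} [Fintype n] [DecidableEq n] {A B : Matrix n n ℂ}
    (h : A * B = B * A) : A * NormedSpace.exp B = NormedSpace.exp B * A :=
  Commute.exp_right (show Commute A B from h)

/-- The sites that are empty or doubly occupied. -/
def pairedSet (σ : X → Fin 4) : Finset X := Finset.univ.filter fun x => σ x = 0 ∨ σ x = 3

/-- The number of doubly occupied sites. -/
def pairCount (σ : X → Fin 4) : ℕ := (Finset.univ.filter fun x => σ x = 3).card

theorem pairCount_le (σ : X → Fin 4) : pairCount σ ≤ (pairedSet σ).card :=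
  Finset.card_le_card (Finset.monotone_filter_right _ fun _ _ h => Or.inr h)

/-- The projection onto states with paired sites `P`, among which `m` are doubly occupied. -/
def sector (P : Finset X) (m : ℕ) : Matrix (X → Fin 4) (X → Fin 4) ℂ :=
  Matrix.diagonal fun σ => if pairedSet σ = P ∧ pairCount σ = m then 1 else 0

theorem sum_sector : ∑ P : Finset X, ∑ m ∈ Finset.range (P.card + 1), sector P m = 1 := by
  ext σ τ
  simp only [Matrix.sum_apply, sector]
  by_cases h : σ = τ
  · subst h
    simp only [Matrix.diagonal_apply_eq, Matrix.one_apply_eq]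
    rw [Finset.sum_eq_single (pairedSet σ), Finset.sum_eq_single (pairCount σ)]
    · simp
    · intro m _ hm
      rw [if_neg fun h => hm h.2.symm]
    · intro h
      exact absurd (Finset.mem_range.2 (Nat.lt_succ_of_le (pairCount_le σ))) h
    · intro P _ hP
      exact Finset.sum_eq_zero fun m _ => if_neg fun h => hP h.1.symm
    · intro h
      exact absurd (Finset.mem_univ _) h
  · simp [Matrix.diagonal_apply_ne _ h, Matrix.one_apply_ne h]

theorem sum_site_diagonal (d : Fin 4 → ℂ) :
    ∑ x : X, site x (Matrix.diagonal d) = Matrix.diagonal fun σ : X → Fin 4 => ∑ x, d (σ x) := by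
  ext σ τ
  simp only [site_diagonal, Matrix.sum_apply]
  by_cases h : σ = τ
  · simp [h]
  · simp [Matrix.diagonal_apply_ne _ h]

theorem sum_site_doubleProj :
    ∑ x : X, site x doubleProj = Matrix.diagonal fun σ : X → Fin 4 => (pairCount σ : ℂ) := by
  rw [doubleProj, sum_site_diagonal]
  congr 1
  funext σ
  rw [pairCount, Finset.card_filter]
  push_cast
  refine Finset.sum_congr rfl fun x _ => ?_
  generalize σ x = i
  fin_cases i <;> simp

/-- The difference of the numbers of empty and doubly occupied sites. -/
def imbalance (X : Type) [LinearOrder X] [Fintype X] : Matrix (X → Fin 4) (X → Fin 4) ℂ :=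
  Matrix.diagonal fun σ => ((pairedSet σ).card : ℂ) - 2 * pairCount σ

theorem imbalance_eq :
    imbalance X = ∑ x : X, site x (Matrix.diagonal ![1, 0, 0, -1]) := by
  rw [imbalance, sum_site_diagonal]
  congr 1
  funext σ
  rw [pairCount, pairedSet, Finset.card_filter, Finset.card_filter]
  push_cast
  rw [Finset.mul_sum, ← Finset.sum_sub_distrib]
  refine Finset.sum_congr rfl fun x _ => ?_
  generalize σ x = i
  fin_cases i <;> simp
  norm_num

/-- The `SU(2)` relation `[S⁻, S⁺] = -2 Sᶻ`, with doubly occupied sites as spins up. As `imbalance`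
is scalar on each sector, this drives the recursion for `spinTrace`. -/
theorem lower_mul_raise : lower X * raise X = raise X * lower X + imbalance X := by
  rw [lower, raise, sum_site_mul_sum_site, imbalance_eq]
  congr 1
  refine Finset.sum_congr rfl fun x _ => ?_
  congr 1
  ext i j
  fin_cases i <;> fin_cases j <;>
    simp [pairLower, pairRaise]

theorem imbalance_comm :
    imbalance X * (raise X * lower X) = raise X * lower X * imbalance X := by
  refine mul_comm_of_commutator (c := -2) ?_ ?_
  · rw [imbalance_eq, raise, sum_site_mul_sum_site, Finset.smul_sum]
    congr 1
    refine Finset.sum_congr rfl fun x _ => ?_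
    rw [← map_smul]
    congr 1
    ext i j
    rw [Matrix.sub_apply, Matrix.diagonal_mul, Matrix.mul_diagonal]
    fin_cases i <;> fin_cases j <;> simp [pairRaise]
    norm_num
  · rw [imbalance_eq, lower, sum_site_mul_sum_site, Finset.smul_sum]
    congr 1
    refine Finset.sum_congr rfl fun x _ => ?_
    rw [← map_smul]
    congr 1
    ext i j
    rw [Matrix.sub_apply, Matrix.diagonal_mul, Matrix.mul_diagonal]
    fin_cases i <;> fin_cases j <;> simp [pairLower]
    norm_num

theorem doubleProj_comm :
    (∑ x : X, site x doubleProj) * (raise X * lower X)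
      = raise X * lower X * ∑ x : X, site x doubleProj := by
  refine mul_comm_of_commutator (c := 1) ?_ ?_
  · rw [raise, sum_site_mul_sum_site, Finset.smul_sum]
    congr 1
    refine Finset.sum_congr rfl fun x _ => ?_
    rw [← map_smul]
    congr 1
    ext i j
    rw [Matrix.sub_apply, doubleProj, Matrix.diagonal_mul, Matrix.mul_diagonal]
    fin_cases i <;> fin_cases j <;> simp [pairRaise]
  · rw [lower, sum_site_mul_sum_site, Finset.smul_sum]
    congr 1
    refine Finset.sum_congr rfl fun x _ => ?_
    rw [← map_smul]
    congr 1
    ext i j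
    rw [Matrix.sub_apply, doubleProj, Matrix.diagonal_mul, Matrix.mul_diagonal]
    fin_cases i <;> fin_cases j <;> simp [pairLower]

variable (β μ th : ℝ) (b : X → E3)

/-- At one site both products vanish, since the factors live on orthogonal states; at different
sites the operators commute. -/
theorem singleExponent_sum_comm {B : Matrix (Fin 4) (Fin 4) ℂ}
    (h1 : singleProj * B = 0) (h2 : B * singleProj = 0) :
    (∑ x, site x (singleExponent β μ th (b x))) * (∑ x, site x B)
      = (∑ x, site x B) * (∑ x, site x (singleExponent β μ th (b x))) := by
  rw [sum_site_mul_sum_site, add_eq_left]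
  refine Finset.sum_eq_zero fun x _ => ?_
  have h3 : fieldMat (β * th) (b x) * B = 0 := by
    rw [← fieldMat_mul_singleProj, mul_assoc, h1, mul_zero]
  have h4 : B * fieldMat (β * th) (b x) = 0 := by
    rw [← singleProj_mul_fieldMat, ← mul_assoc, h2, zero_mul]
  rw [singleExponent, add_mul, mul_add, smul_mul_assoc, mul_smul_comm, h1, h2, h3, h4]
  simp

theorem singleExponent_comm_lower :
    (∑ x, site x (singleExponent β μ th (b x))) * lower X
      = lower X * (∑ x, site x (singleExponent β μ th (b x))) := by
  refine singleExponent_sum_comm β μ th b ?_ ?_ <;> ext i j <;> fin_cases i <;> fin_cases j <;>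
    simp [singleProj, pairLower]

theorem singleExponent_comm_raise :
    (∑ x, site x (singleExponent β μ th (b x))) * raise X
      = raise X * (∑ x, site x (singleExponent β μ th (b x))) := by
  refine singleExponent_sum_comm β μ th b ?_ ?_ <;> ext i j <;> fin_cases i <;> fin_cases j <;>
    simp [singleProj, pairRaise]

theorem singleExponent_comm_doubleProj :
    (∑ x, site x (singleExponent β μ th (b x))) * (∑ x, site x doubleProj)
      = (∑ x, site x doubleProj) * (∑ x, site x (singleExponent β μ th (b x))) := by
  refine singleExponent_sum_comm β μ th b ?_ ?_ <;> ext i j <;> fin_cases i <;> fin_cases j <;>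
    simp [singleProj, doubleProj]

theorem lower_apply_ne_zero {σ τ : X → Fin 4} (h : lower X σ τ ≠ 0) :
    pairedSet σ = pairedSet τ ∧ pairCount τ = pairCount σ + 1 := by
  rw [lower, Matrix.sum_apply] at h
  obtain ⟨x, -, hx⟩ := Finset.exists_ne_zero_of_sum_ne_zero h
  rw [site_apply] at hx
  have h1 : ∀ y, y ≠ x → σ y = τ y := by
    by_contra hc
    rw [if_neg hc] at hx
    exact hx rfl
  rw [if_pos h1] at hx
  have h2 : ∀ i j : Fin 4, pairLower i j ≠ 0 → i = 0 ∧ j = 3 := by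
    intro i j
    fin_cases i <;> fin_cases j <;> simp [pairLower]
  obtain ⟨hσ, hτ⟩ := h2 _ _ hx
  constructor
  · ext y
    simp only [pairedSet, Finset.mem_filter, Finset.mem_univ, true_and]
    by_cases hy : y = x
    · subst hy
      simp [hσ, hτ]
    · rw [h1 y hy]
  · have : (Finset.univ.filter fun y => τ y = 3)
        = insert x (Finset.univ.filter fun y => σ y = 3) := by
      ext y
      simp only [Finset.mem_filter, Finset.mem_univ, true_and, Finset.mem_insert]
      by_cases hy : y = x
      · subst hy
        simp [hτ]
      · simp [h1 y hy, hy]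
    rw [pairCount, this, Finset.card_insert_of_notMem, pairCount]
    simp [hσ]

theorem lower_mul_sector_succ (P : Finset X) (m : ℕ) :
    lower X * sector P (m + 1) = sector P m * lower X := by
  ext σ τ
  rw [sector, sector, Matrix.mul_diagonal, Matrix.diagonal_mul]
  by_cases h : lower X σ τ = 0
  · simp [h]
  · obtain ⟨h1, h2⟩ := lower_apply_ne_zero h
    rw [h1, h2, mul_comm]
    simp

theorem lower_mul_sector_zero (P : Finset X) : lower X * sector P 0 = 0 := by
  ext σ τ
  rw [sector, Matrix.mul_diagonal]
  by_cases h : lower X σ τ = 0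
  · simp [h]
  · obtain ⟨h1, h2⟩ := lower_apply_ne_zero h
    simp [h2]

/-! ### Traces over the sectors. -/

theorem sum_paired_weights (P : Finset X) (m : ℕ) (f : X → Fin 4 → ℂ)
    (h0 : ∀ x, f x 0 = 1) (h3 : ∀ x, f x 3 = 1) :
    ∑ σ : X → Fin 4, (if pairedSet σ = P ∧ pairCount σ = m then 1 else 0) * ∏ x, f x (σ x)
      = (∏ x ∈ Pᶜ, (f x 1 + f x 2)) * (P.card.choose m : ℂ) := by
  open Polynomial in
  -- Generating polynomial whose variable marks doubly occupied sites. It factorizes over the sites,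
  -- each paired site contributing `1 + X`; the coefficient of degree `m` is the claim.
  have key : ∑ σ : X → Fin 4, (if pairedSet σ = P then C (∏ x, f x (σ x)) else 0)
        * (Polynomial.X : ℂ[X]) ^ pairCount σ
      = C (∏ x ∈ Pᶜ, (f x 1 + f x 2)) * (1 + Polynomial.X) ^ P.card := by
    have h1 : ∀ σ : X → Fin 4, (if pairedSet σ = P then C (∏ x, f x (σ x)) else 0)
        * (Polynomial.X : ℂ[X]) ^ pairCount σ
        = ∏ x, ((if (σ x = 0 ∨ σ x = 3) ↔ x ∈ P then C (f x (σ x)) else 0)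
          * if σ x = 3 then Polynomial.X else 1) := by
      intro σ
      rw [Finset.prod_mul_distrib]
      congr 1
      · have : pairedSet σ = P ↔ ∀ x, ((σ x = 0 ∨ σ x = 3) ↔ x ∈ P) := by
          simp [pairedSet, Finset.ext_iff]
        split_ifs with h
        · rw [map_prod]
          exact Finset.prod_congr rfl fun x _ => (if_pos (this.1 h x)).symm
        · rw [this] at h
          push Not at h
          obtain ⟨x, hx⟩ := h
          refine (Finset.prod_eq_zero (Finset.mem_univ x) (if_neg ?_)).symm
          tauto
      · rw [pairCount, ← Finset.prod_const, Finset.prod_filter]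
    simp only [h1]
    have h2 := Finset.prod_univ_sum (fun _ : X => (Finset.univ : Finset (Fin 4)))
      (fun x i => (if (i = 0 ∨ i = 3) ↔ x ∈ P then C (f x i) else 0)
          * if i = 3 then (Polynomial.X : ℂ[X]) else 1)
    rw [Fintype.piFinset_univ] at h2
    rw [← h2, ← Finset.prod_mul_prod_compl P, mul_comm, map_prod, ← Finset.prod_const]
    congr 1
    · refine Finset.prod_congr rfl fun x hx => ?_
      have hx : x ∉ P := Finset.mem_compl.1 hx
      simp [Fin.sum_univ_four, hx]
    · refine Finset.prod_congr rfl fun x hx => ?_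
      simp [Fin.sum_univ_four, hx, h0, h3]
  have hc := congrArg (fun p => Polynomial.coeff p m) key
  simp only [Polynomial.finsetSum_coeff, Polynomial.coeff_C_mul,
    Polynomial.coeff_one_add_X_pow] at hc
  rw [← hc]
  refine Finset.sum_congr rfl fun σ _ => ?_
  by_cases h : pairedSet σ = P
  · simp only [h, true_and, if_true, Polynomial.coeff_C_mul, Polynomial.coeff_X_pow]
    by_cases hm : pairCount σ = m
    · simp [hm]
    · simp [hm, Ne.symm hm]
  · simp [h]

theorem trace_sector_mul_exp (P : Finset X) (m : ℕ) :
    (sector P m * NormedSpace.exp (∑ x, site x (singleExponent β μ th (b x)))).trace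
      = (((∏ x ∈ Pᶜ, singleWeight β μ th (b x)) * P.card.choose m : ℝ) : ℂ) := by
  -- The unknown coefficients `s x` cancel below: the diagonal entries of `fieldMat` on the two
  -- singly occupied states are opposite.
  choose s hs using fun x => exp_singleExponent β μ th (b x)
  rw [exp_sum_site, sector, Matrix.trace]
  simp only [Matrix.diag, Matrix.diagonal_mul, piTensor_apply, hs]
  rw [sum_paired_weights P m (fun x i => (1 + ((Real.exp (β * μ) * Real.cosh (β * th * ‖b x‖) - 1
    : ℝ) : ℂ) • singleProj + s x • fieldMat (β * th) (b x)) i i)]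
  · push_cast
    congr 1
    refine Finset.prod_congr rfl fun x _ => ?_
    simp [singleProj, fieldMat, singleWeight]
    ring
  · intro x
    simp [singleProj, fieldMat]
  · intro x
    simp [singleProj, fieldMat]

/-- The trace of `exp (c S⁺ S⁻)` over the states of `k` spins, `m` of which are up, computed
recursively in `m`. -/
def spinTrace (c : ℝ) (k : ℕ) : ℕ → ℝ
  | 0 => 1
  | m + 1 => Real.exp (c * (k - 2 * m)) * spinTrace c k m + (k.choose (m + 1) - k.choose m)

/-- Moving `lower` around the trace replaces `S⁺ S⁻` on the sector `m + 1` by `S⁻ S⁺` on the sector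
`m`. The latter is `S⁺ S⁻` plus the scalar `k - 2 m`, with `k = P.card`. The zeroth-order terms,
which cyclicity does not match, give the difference of binomials. -/
theorem trace_sector_mul_exp_pair (c : ℝ) (P : Finset X) (m : ℕ) :
    (sector P m * NormedSpace.exp (∑ x, site x (singleExponent β μ th (b x)))
        * NormedSpace.exp ((c : ℂ) • (raise X * lower X))).trace
      = (((∏ x ∈ Pᶜ, singleWeight β μ th (b x)) * spinTrace c P.card m : ℝ) : ℂ) := by
  set W := NormedSpace.exp (∑ x, site x (singleExponent β μ th (b x))) with hW
  have hYW : lower X * W = W * lower X :=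
    mul_exp_comm (singleExponent_comm_lower β μ th b).symm
  induction m with
  | zero =>
    -- With no doubly occupied site there is nothing to lower, so only the zeroth-order term of the
    -- exponential survives.
    have h : lower X * (sector P 0 * W) = 0 * lower X := by
      rw [← mul_assoc, lower_mul_sector_zero, zero_mul, zero_mul]
    have := trace_mul_exp_sub_trace (X := raise X) h (c : ℂ)
    simp only [zero_mul, Matrix.trace_zero, sub_self] at this
    rw [sub_eq_zero.1 this, trace_sector_mul_exp]
    simp [spinTrace]
  | succ m ih =>
    have h : lower X * (sector P (m + 1) * W) = sector P m * W * lower X := by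
      rw [← mul_assoc, lower_mul_sector_succ, mul_assoc, hYW, mul_assoc]
    have h1 := trace_mul_exp_sub_trace (X := raise X) h (c : ℂ)
    have h2 : (sector P m * W * NormedSpace.exp ((c : ℂ) • (lower X * raise X))).trace
        = Complex.exp (c * (P.card - 2 * m)) *
          (sector P m * W * NormedSpace.exp ((c : ℂ) • (raise X * lower X))).trace := by
      rw [lower_mul_raise, smul_add, exp_add_of_commute, ← mul_assoc, Matrix.trace_mul_comm,
        ← mul_assoc, ← mul_assoc]
      · have : NormedSpace.exp ((c : ℂ) • imbalance X) * sector P m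
            = Complex.exp (c * (P.card - 2 * m)) • sector P m := by
          rw [imbalance, ← Matrix.diagonal_smul, Matrix.exp_diagonal, sector,
            Matrix.diagonal_mul_diagonal, ← Matrix.diagonal_smul]
          congr 1
          funext σ
          rw [Pi.coe_exp]
          by_cases hσ : pairedSet σ = P ∧ pairCount σ = m
          · simp [hσ, ← Complex.exp_eq_exp_ℂ]
          · simp [hσ]
        rw [this, smul_mul_assoc, smul_mul_assoc, Matrix.trace_smul, smul_eq_mul]
      · rw [smul_mul_smul_comm, smul_mul_smul_comm, imbalance_comm]
    rw [h2, ih, trace_sector_mul_exp, trace_sector_mul_exp] at h1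
    rw [sub_eq_iff_eq_add.1 h1, spinTrace]
    push_cast
    ring

/-- The double-occupancy, field and pairing parts of the exponent commute pairwise, so the
exponential splits. Inserting the resolution of identity `sum_sector` makes the first factor a
scalar on each sector. -/
theorem partitionFunction_eq (lam γ : ℝ) :
    partitionFunction β μ lam γ th b
      = ∑ P : Finset X, (∏ x ∈ Pᶜ, singleWeight β μ th (b x)) *
          ∑ m ∈ Finset.range (P.card + 1), Real.exp (2 * β * (μ - lam) * m)
            * spinTrace (β * γ / Fintype.card X) P.card m := by
  set L := ∑ x, site x (singleExponent β μ th (b x)) with hL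
  set c : ℝ := β * γ / Fintype.card X with hc
  set a : ℝ := 2 * β * (μ - lam) with ha
  have h1 : NormedSpace.exp (exponent β μ lam γ th b)
      = NormedSpace.exp ((a : ℂ) • ∑ x : X, site x doubleProj)
        * (NormedSpace.exp L * NormedSpace.exp ((c : ℂ) • (raise X * lower X))) := by
    have h2 : L * (raise X * lower X) = raise X * lower X * L := by
      rw [← mul_assoc, singleExponent_comm_raise, mul_assoc, singleExponent_comm_lower, mul_assoc]
    rw [exponent, ← hL, ← hc, ← ha, add_comm L, add_assoc, exp_add_of_commute, exp_add_of_commute]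
    · rw [mul_smul_comm, smul_mul_assoc, h2]
    · simp only [mul_add, add_mul, mul_smul_comm, smul_mul_assoc, doubleProj_comm,
        singleExponent_comm_doubleProj β μ th b, hL]
      module
  rw [partitionFunction, h1, ← one_mul (NormedSpace.exp ((a : ℂ) • ∑ x : X, site x doubleProj) * _), ← sum_sector,
    Finset.sum_mul, Matrix.trace_sum, Complex.re_sum]
  refine Finset.sum_congr rfl fun P _ => ?_
  rw [Finset.sum_mul, Matrix.trace_sum, Complex.re_sum, Finset.mul_sum]
  refine Finset.sum_congr rfl fun m _ => ?_
  have h3 : sector P m * NormedSpace.exp ((a : ℂ) • ∑ x : X, site x doubleProj)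
      = Complex.exp (a * m) • sector P m := by
    rw [sum_site_doubleProj, ← Matrix.diagonal_smul, Matrix.exp_diagonal, sector,
      Matrix.diagonal_mul_diagonal, ← Matrix.diagonal_smul]
    congr 1
    funext σ
    rw [Pi.coe_exp]
    by_cases hσ : pairedSet σ = P ∧ pairCount σ = m
    · simp [hσ, ← Complex.exp_eq_exp_ℂ]
    · simp [hσ]
  rw [← mul_assoc, h3, smul_mul_assoc, Matrix.trace_smul, ← mul_assoc, hL,
    trace_sector_mul_exp_pair, smul_eq_mul]
  have : Complex.exp (a * m) = ((Real.exp (a * m) : ℝ) : ℂ) := by push_cast; rfl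
  rw [this, ← Complex.ofReal_mul, Complex.ofReal_re]
  ring

end Sectors

/-! ### Bounds on the partition function -/

section Bounds

/-- The multiplicity of the spin `k / 2 - j` in the tensor product of `k` spins `1 / 2`. -/
def spinMult (k j : ℕ) : ℝ := k.choose j - if j = 0 then 0 else (k.choose (j - 1) : ℝ)

theorem spinMult_zero (k : ℕ) : spinMult k 0 = 1 := by simp [spinMult]

theorem spinMult_succ (k j : ℕ) : spinMult k (j + 1) = k.choose (j + 1) - k.choose j := by
  simp [spinMult]

theorem spinMult_le (k j : ℕ) : spinMult k j ≤ k.choose j := by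
  rw [spinMult]
  split_ifs <;> simp

theorem spinMult_nonneg {k j : ℕ} (h : 2 * j ≤ k) : 0 ≤ spinMult k j := by
  rcases j with _ | j
  · simp [spinMult_zero]
  · rw [spinMult_succ, sub_nonneg]
    exact_mod_cast Nat.choose_le_succ_of_lt_half_left (by omega)

/-- Clebsch-Gordan decomposition of `k` spins 1/2: on the spin `k / 2 - j` with `m` spins up, `S⁺
S⁻` has eigenvalue `(m - j)(k - m - j + 1)`. The proof only solves the recursion: going from `m` to
`m + 1` raises this eigenvalue by `k - 2 m` for every `j`. -/
theorem spinTrace_eq (c : ℝ) (k m : ℕ) (hm : m ≤ k) :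
    spinTrace c k m = ∑ j ∈ Finset.range (min m (k - m) + 1),
      spinMult k j * Real.exp (c * (((m : ℝ) - j) * ((k : ℝ) - m - j + 1))) := by
  induction m with
  | zero => simp [spinTrace, spinMult_zero]
  | succ m ih =>
    have h1 : ∀ j : ℕ, Real.exp (c * (k - 2 * m)) * (spinMult k j *
        Real.exp (c * (((m : ℝ) - j) * ((k : ℝ) - m - j + 1))))
        = spinMult k j *
          Real.exp (c * ((((m + 1 : ℕ) : ℝ) - j) * ((k : ℝ) - (m + 1 : ℕ) - j + 1))) := by
      intro j
      rw [mul_left_comm, ← Real.exp_add]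
      congr 2
      push_cast
      ring
    rw [spinTrace, ih (by omega), Finset.mul_sum]
    simp only [h1]
    -- Below the middle a new spin `j = m + 1` appears, with eigenvalue `0`. At the middle the two
    -- binomials agree. Above it the spin `j = k - m` disappears: its eigenvalue has become `0`, and
    -- its multiplicity cancels the difference of binomials.
    rcases lt_trichotomy (2 * (m + 1)) (k + 1) with h | h | h
    · have e1 : min m (k - m) = m := by omega
      have e2 : min (m + 1) (k - (m + 1)) = m + 1 := by omega
      rw [e1, e2, Finset.sum_range_succ _ (m + 1), spinMult_succ, sub_self, zero_mul, mul_zero,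
        Real.exp_zero, mul_one]
    · have e1 : min m (k - m) = m := by omega
      have e2 : min (m + 1) (k - (m + 1)) = m := by omega
      have e3 : k.choose (m + 1) = k.choose m := by
        rw [show k = 2 * m + 1 by omega]
        exact Nat.choose_symm_half m
      rw [e1, e2, e3, sub_self, add_zero]
    · have e1 : min m (k - m) = (k - (m + 1)) + 1 := by omega
      have e2 : min (m + 1) (k - (m + 1)) = k - (m + 1) := by omega
      have e3 : ((k - (m + 1) + 1 : ℕ) : ℝ) = k - m := by
        rw [show k - (m + 1) + 1 = k - m by omega, Nat.cast_sub (by omega)]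
      have e4 : k.choose (k - (m + 1) + 1) = k.choose m := by
        rw [show k - (m + 1) + 1 = k - m by omega]
        exact Nat.choose_symm (by omega)
      have e5 : k.choose (k - (m + 1)) = k.choose (m + 1) := Nat.choose_symm hm
      rw [e1, e2, Finset.sum_range_succ _ (k - (m + 1) + 1), spinMult_succ, e3, e4, e5]
      have : (k : ℝ) - ((m + 1 : ℕ) : ℝ) - (k - m) + 1 = 0 := by
        push_cast
        ring
      rw [this, mul_zero, mul_zero, Real.exp_zero]
      ring

theorem spinTrace_nonneg (c : ℝ) {k m : ℕ} (hm : m ≤ k) : 0 ≤ spinTrace c k m := by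
  rw [spinTrace_eq c k m hm]
  refine Finset.sum_nonneg fun j hj => mul_nonneg (spinMult_nonneg ?_) (Real.exp_nonneg _)
  have := Finset.mem_range.1 hj
  omega

theorem spinTrace_le (c : ℝ) {k m : ℕ} (hm : m ≤ k) :
    spinTrace c k m ≤ ∑ j ∈ Finset.range (min m (k - m) + 1),
      (k.choose j : ℝ) * Real.exp (c * (((m : ℝ) - j) * ((k : ℝ) - m - j + 1))) := by
  rw [spinTrace_eq c k m hm]
  exact Finset.sum_le_sum fun j _ =>
    mul_le_mul_of_nonneg_right (spinMult_le k j) (Real.exp_nonneg _)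

/-- The left side is a single term of the binomial expansion of `(exp (-s) + exp s) ^ k`. -/
theorem choose_mul_exp_le_pow (k j : ℕ) (hj : j ≤ k) (s : ℝ) :
    (k.choose j : ℝ) * Real.exp (s * (k - 2 * j)) ≤ (2 * Real.cosh s) ^ k := by
  have h : 2 * Real.cosh s = Real.exp (-s) + Real.exp s := by
    rw [Real.cosh_eq]
    ring
  rw [h, add_pow]
  refine le_trans (le_of_eq ?_) (Finset.single_le_sum (f := fun i =>
    Real.exp (-s) ^ i * Real.exp s ^ (k - i) * (k.choose i : ℝ)) (fun i _ => by positivity)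
    (Finset.mem_range.2 (Nat.lt_succ_of_le hj)))
  rw [← Real.exp_nat_mul, ← Real.exp_nat_mul, ← Real.exp_add, mul_comm, Nat.cast_sub hj]
  congr 2
  ring

/-- The order parameter of the spin `k / 2 - j` with `m` spins up. -/
def spinOrder (N k m j : ℕ) : ℝ := (((m - j : ℕ) : ℝ) * ((k - m - j : ℕ) : ℝ)) / (N : ℝ) ^ 2

theorem spinOrder_nonneg (N k m j : ℕ) : 0 ≤ spinOrder N k m j := by
  unfold spinOrder
  positivity

theorem pairWeight_pos (β μ lam γ r : ℝ) : 0 < pairWeight β μ lam γ r := by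
  unfold pairWeight
  have := Real.cosh_pos (√((β * (μ - lam)) ^ 2 + (β * γ * √r) ^ 2))
  positivity

theorem singleWeight_pos (β μ th : ℝ) (b : E3) : 0 < singleWeight β μ th b := by
  unfold singleWeight
  have := Real.cosh_pos (β * th * ‖b‖)
  positivity

/-- With `p = m - j` and `q = k - m - j`, the choice `r = p q / N²` makes `β γ r N` equal to `c p q`
and the squared gap equal to `u² + c² p q`. The factor `exp (β γ)` pays for the quantum correction
`c p` in `c p (q + 1)`, and `p + q = k - 2 j` matches `choose_mul_exp_le_pow`. -/
theorem choose_mul_exp_le_pairWeight_pow {β γ : ℝ} (hβ : 0 < β) (hγ : 0 < γ) (μ lam : ℝ)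
    {N k m j : ℕ} (hN : 0 < N) (hk : k ≤ N) (hm : m ≤ k) (hj : j ≤ min m (k - m)) :
    Real.exp (2 * β * (μ - lam) * m) * ((k.choose j : ℝ) *
        Real.exp (β * γ / N * (((m : ℝ) - j) * ((k : ℝ) - m - j + 1))))
      ≤ Real.exp (β * γ) * (Real.exp (-(β * γ * spinOrder N k m j * N))
        * pairWeight β μ lam γ (spinOrder N k m j) ^ k) := by
  have hN' : (0 : ℝ) < N := by exact_mod_cast hN
  set p : ℝ := (m : ℝ) - j with hp
  set q : ℝ := (k : ℝ) - m - j with hq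
  set u : ℝ := β * (μ - lam) with hu
  set c : ℝ := β * γ / N with hc
  set r : ℝ := spinOrder N k m j with hr
  have hc0 : 0 < c := by positivity
  have hp0 : 0 ≤ p := by
    have : (j : ℝ) ≤ m := by exact_mod_cast (by omega : j ≤ m)
    linarith
  have hq0 : 0 ≤ q := by
    have : ((m + j : ℕ) : ℝ) ≤ k := by exact_mod_cast (by omega : m + j ≤ k)
    push_cast at this
    linarith
  have hrpq : r = p * q / (N : ℝ) ^ 2 := by
    rw [hr, spinOrder, Nat.cast_sub (by omega), Nat.cast_sub (by omega), Nat.cast_sub hm]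
  have hr0 : 0 ≤ r := spinOrder_nonneg _ _ _ _
  set s : ℝ := √(u ^ 2 + (β * γ * √r) ^ 2) with hs
  have hs2 : s ^ 2 = u ^ 2 + c ^ 2 * (p * q) := by
    rw [hs, Real.sq_sqrt (by positivity), mul_pow _ (√r), Real.sq_sqrt hr0, hrpq, hc]
    field_simp
  have hs0 : 0 ≤ s := Real.sqrt_nonneg _
  -- The squares of the two sides differ by the nonnegative quantity `p q (2 u - c (p - q))²`.
  have hmain : u * (p - q) + 2 * c * (p * q) ≤ s * (p + q) := by
    refine le_of_sq_le_sq ?_ (by positivity)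
    have : (s * (p + q)) ^ 2 - (u * (p - q) + 2 * c * (p * q)) ^ 2
        = p * q * (2 * u - c * (p - q)) ^ 2 := by
      rw [mul_pow, hs2]
      ring
    have h2 : 0 ≤ p * q * (2 * u - c * (p - q)) ^ 2 := by positivity
    linarith
  have hpN : c * p ≤ β * γ := by
    have : p ≤ N := by
      have h1 : (m : ℝ) ≤ N := by exact_mod_cast hm.trans hk
      have h2 : (0 : ℝ) ≤ j := by positivity
      linarith
    calc c * p ≤ c * N := mul_le_mul_of_nonneg_left this hc0.le
      _ = β * γ := by rw [hc]; field_simp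
  have hrN : β * γ * r * N = c * (p * q) := by
    rw [hrpq, hc]
    field_simp
  have hpow := choose_mul_exp_le_pow k j (by omega) s
  have hz : pairWeight β μ lam γ r ^ k = Real.exp (u * k) * (2 * Real.cosh s) ^ k := by
    rw [pairWeight, mul_comm u, Real.exp_nat_mul, ← mul_pow]
    ring
  rw [hrN, hz]
  calc Real.exp (2 * β * (μ - lam) * m) * ((k.choose j : ℝ) * Real.exp (c * (p * (q + 1))))
      = (k.choose j : ℝ) * Real.exp (2 * u * m + c * (p * (q + 1))) := by
        rw [Real.exp_add, hu]
        ring_nf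
    _ ≤ (k.choose j : ℝ) * Real.exp (β * γ + -(c * (p * q)) + u * k + s * (k - 2 * j)) := by
        refine mul_le_mul_of_nonneg_left (Real.exp_le_exp.2 ?_) (by positivity)
        have e1 : s * ((k : ℝ) - 2 * j) = s * (p + q) := by
          rw [hp, hq]
          ring
        have e2 : 2 * u * (m : ℝ) = u * k + u * (p - q) := by
          rw [hp, hq]
          ring
        rw [e1, e2]
        linarith
    _ = Real.exp (β * γ) * (Real.exp (-(c * (p * q))) * (Real.exp (u * k) *
          ((k.choose j : ℝ) * Real.exp (s * (k - 2 * j))))) := by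
        rw [Real.exp_add, Real.exp_add, Real.exp_add]
        ring
    _ ≤ _ := by gcongr

variable {X : Type} [LinearOrder X] [Fintype X]

/-- The upper bound on the partition function by the approximating Hamiltonians. -/
theorem partitionFunction_le [Nonempty X] {β γ : ℝ} (hβ : 0 < β) (hγ : 0 < γ) (μ lam th : ℝ)
    (b : X → E3) {M : ℝ}
    (hM : ∀ r, 0 ≤ r → Real.exp (-(β * γ * r * Fintype.card X))
        * ∏ x, (singleWeight β μ th (b x) + pairWeight β μ lam γ r) ≤ M) :
    partitionFunction β μ lam γ th b
      ≤ ((Fintype.card X : ℝ) + 1) ^ 3 * (Real.exp (β * γ) * M) := by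
  set N := Fintype.card X with hN
  have hN0 : 0 < N := Fintype.card_pos
  set f : ℕ → ℕ → ℕ → Finset X → ℝ := fun k m j P =>
    (∏ x ∈ Pᶜ, singleWeight β μ th (b x)) * (Real.exp (β * γ) *
      (Real.exp (-(β * γ * spinOrder N k m j * N))
        * pairWeight β μ lam γ (spinOrder N k m j) ^ P.card)) with hf
  have hf0 : ∀ k m j P, 0 ≤ f k m j P := fun k m j P =>
    mul_nonneg (Finset.prod_nonneg fun x _ => (singleWeight_pos _ _ _ _).le)
      (mul_nonneg (Real.exp_nonneg _) (mul_nonneg (Real.exp_nonneg _)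
        (pow_nonneg (pairWeight_pos _ _ _ _ _).le _)))
  -- For fixed `(k, m, j)` the order parameter does not depend on `P`, so the sum over all `P` is
  -- the expansion of the product of the sums `singleWeight + pairWeight`.
  have hsum : ∀ k m j, ∑ P : Finset X, f k m j P ≤ Real.exp (β * γ) * M := by
    intro k m j
    have h1 := hM _ (spinOrder_nonneg N k m j)
    have h2 : ∑ P : Finset X, f k m j P = Real.exp (β * γ) *
        (Real.exp (-(β * γ * spinOrder N k m j * N))
        * ∏ x, (singleWeight β μ th (b x) + pairWeight β μ lam γ (spinOrder N k m j))) := by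
      simp only [add_comm (singleWeight _ _ _ _)]
      rw [Finset.prod_add, Finset.powerset_univ, Finset.mul_sum, Finset.mul_sum]
      refine Finset.sum_congr rfl fun P _ => ?_
      rw [hf, Finset.prod_const, ← Finset.compl_eq_univ_sdiff]
      ring
    rw [h2]
    exact mul_le_mul_of_nonneg_left h1 (Real.exp_nonneg _)
  rw [partitionFunction_eq, ← hN]
  calc ∑ P : Finset X, (∏ x ∈ Pᶜ, singleWeight β μ th (b x)) *
          ∑ m ∈ Finset.range (P.card + 1), Real.exp (2 * β * (μ - lam) * m)
            * spinTrace (β * γ / N) P.card m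
      ≤ ∑ P : Finset X, ∑ m ∈ Finset.range (P.card + 1),
          ∑ j ∈ Finset.range (min m (P.card - m) + 1), f P.card m j P := by
        refine Finset.sum_le_sum fun P _ => ?_
        rw [Finset.mul_sum]
        refine Finset.sum_le_sum fun m hm => ?_
        have hm : m ≤ P.card := Nat.lt_succ_iff.1 (Finset.mem_range.1 hm)
        simp only [hf]
        rw [← Finset.mul_sum]
        refine mul_le_mul_of_nonneg_left ?_
          (Finset.prod_nonneg fun x _ => (singleWeight_pos _ _ _ _).le)
        refine (mul_le_mul_of_nonneg_left (spinTrace_le _ hm) (Real.exp_nonneg _)).trans ?_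
        rw [Finset.mul_sum]
        refine Finset.sum_le_sum fun j hj => ?_
        exact choose_mul_exp_le_pairWeight_pow hβ hγ μ lam hN0 (Finset.card_le_univ P) hm
          (Nat.lt_succ_iff.1 (Finset.mem_range.1 hj))
    -- Nonnegative terms are added to make `k` independent of `P.card` and the ranges independent of
    -- `P`, so that the sums can be exchanged.
    _ ≤ ∑ P : Finset X, ∑ k ∈ Finset.range (N + 1), ∑ m ∈ Finset.range (N + 1),
          ∑ j ∈ Finset.range (N + 1), f k m j P := by
        refine Finset.sum_le_sum fun P _ => ?_
        have hP : P.card ≤ N := Finset.card_le_univ P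
        refine le_trans ?_ (Finset.single_le_sum (f := fun k => ∑ m ∈ Finset.range (N + 1),
          ∑ j ∈ Finset.range (N + 1), f k m j P) (fun k _ => Finset.sum_nonneg fun m _ =>
            Finset.sum_nonneg fun j _ => hf0 k m j P) (Finset.mem_range.2 (Nat.lt_succ_of_le hP)))
        refine (Finset.sum_le_sum_of_subset_of_nonneg
          (Finset.range_subset_range.2 (Nat.succ_le_succ hP)) fun m _ _ =>
            Finset.sum_nonneg fun j _ => hf0 _ m j P).trans ?_
        refine Finset.sum_le_sum fun m _ => ?_
        exact Finset.sum_le_sum_of_subset_of_nonneg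
          (Finset.range_subset_range.2 (by omega)) fun j _ _ => hf0 _ m j P
    _ = ∑ k ∈ Finset.range (N + 1), ∑ m ∈ Finset.range (N + 1),
          ∑ j ∈ Finset.range (N + 1), ∑ P : Finset X, f k m j P := by
        rw [Finset.sum_comm]
        refine Finset.sum_congr rfl fun k _ => ?_
        rw [Finset.sum_comm]
        refine Finset.sum_congr rfl fun m _ => ?_
        rw [Finset.sum_comm]
    _ ≤ ∑ k ∈ Finset.range (N + 1), ∑ m ∈ Finset.range (N + 1),
          ∑ j ∈ Finset.range (N + 1), Real.exp (β * γ) * M :=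
        Finset.sum_le_sum fun k _ => Finset.sum_le_sum fun m _ => Finset.sum_le_sum fun j _ =>
          hsum k m j
    _ = ((N : ℝ) + 1) ^ 3 * (Real.exp (β * γ) * M) := by
        simp only [Finset.sum_const, Finset.card_range, nsmul_eq_mul]
        push_cast
        ring

/-! ### Lipschitz dependence on the magnetic induction. -/

theorem cosh_le_exp_mul_cosh (s t : ℝ) : Real.cosh s ≤ Real.exp |s - t| * Real.cosh t := by
  rw [Real.cosh_eq, Real.cosh_eq]
  have h1 : Real.exp s ≤ Real.exp |s - t| * Real.exp t := by
    rw [← Real.exp_add]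
    refine Real.exp_le_exp.2 ?_
    linarith [le_abs_self (s - t)]
  have h2 : Real.exp (-s) ≤ Real.exp |s - t| * Real.exp (-t) := by
    rw [← Real.exp_add]
    refine Real.exp_le_exp.2 ?_
    linarith [neg_abs_le (s - t)]
  linarith

theorem singleWeight_le {β th : ℝ} (hβ : 0 < β) (hth : 0 < th) (μ : ℝ) (b c : E3) :
    singleWeight β μ th b ≤ Real.exp (β * th * ‖b - c‖) * singleWeight β μ th c := by
  have h1 : |β * th * ‖b‖ - β * th * ‖c‖| ≤ β * th * ‖b - c‖ := by
    rw [← mul_sub, abs_mul, abs_of_pos (by positivity)]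
    exact mul_le_mul_of_nonneg_left (abs_norm_sub_norm_le b c) (by positivity)
  have h2 := (cosh_le_exp_mul_cosh (β * th * ‖b‖) (β * th * ‖c‖)).trans
    (mul_le_mul_of_nonneg_right (Real.exp_le_exp.2 h1) (Real.cosh_pos _).le)
  calc singleWeight β μ th b = 2 * Real.exp (β * μ) * Real.cosh (β * th * ‖b‖) := rfl
    _ ≤ 2 * Real.exp (β * μ) * (Real.exp (β * th * ‖b - c‖) * Real.cosh (β * th * ‖c‖)) :=
        mul_le_mul_of_nonneg_left h2 (by positivity)
    _ = _ := by
        rw [singleWeight]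
        ring

theorem partitionFunction_pos [Nonempty X] {β γ : ℝ} (hβ : 0 < β) (hγ : 0 < γ) (μ lam th : ℝ)
    (b : X → E3) : 0 < partitionFunction β μ lam γ th b :=
  (mul_pos (Real.exp_pos _) (Finset.prod_pos fun x _ =>
    add_pos (singleWeight_pos β μ th (b x)) (pairWeight_pos β μ lam γ 0))).trans_le
    (le_partitionFunction hβ hγ μ lam th b le_rfl)

/-- The partition function depends on the magnetic inductions in a Lipschitz continuous way. -/
theorem log_partitionFunction_le [Nonempty X] {β γ th : ℝ} (hβ : 0 < β) (hγ : 0 < γ)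
    (hth : 0 < th) (μ lam : ℝ) (b c : X → E3) :
    Real.log (partitionFunction β μ lam γ th b)
      ≤ Real.log (partitionFunction β μ lam γ th c)
        + β * th * ∑ x, ‖b x - c x‖ := by
  have hpos := partitionFunction_pos hβ hγ μ lam th c
  rw [← Real.log_exp (β * th * ∑ x, ‖b x - c x‖), ← Real.log_mul hpos.ne' (Real.exp_ne_zero _)]
  refine Real.log_le_log (partitionFunction_pos hβ hγ μ lam th b) ?_
  -- In the exact formula the field enters only through `singleWeight`, with nonnegative
  -- coefficients, so the comparison can be made term by term in `P`.
  rw [partitionFunction_eq, partitionFunction_eq, Finset.sum_mul]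
  refine Finset.sum_le_sum fun P _ => ?_
  rw [mul_right_comm (∏ x ∈ Pᶜ, singleWeight β μ th (c x))]
  refine mul_le_mul_of_nonneg_right ?_ (Finset.sum_nonneg fun m hm =>
    mul_nonneg (Real.exp_nonneg _)
      (spinTrace_nonneg _ (Nat.lt_succ_iff.1 (Finset.mem_range.1 hm))))
  calc ∏ x ∈ Pᶜ, singleWeight β μ th (b x)
      ≤ ∏ x ∈ Pᶜ, (singleWeight β μ th (c x) * Real.exp (β * th * ‖b x - c x‖)) :=
        Finset.prod_le_prod (fun x _ => (singleWeight_pos _ _ _ _).le) fun x _ => by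
          rw [mul_comm]
          exact singleWeight_le hβ hth μ _ _
    _ = (∏ x ∈ Pᶜ, singleWeight β μ th (c x)) * Real.exp (∑ x ∈ Pᶜ, β * th * ‖b x - c x‖) := by
        rw [Finset.prod_mul_distrib, Real.exp_sum]
    _ ≤ (∏ x ∈ Pᶜ, singleWeight β μ th (c x)) * Real.exp (β * th * ∑ x, ‖b x - c x‖) := by
        refine mul_le_mul_of_nonneg_left (Real.exp_le_exp.2 ?_)
          (Finset.prod_nonneg fun x _ => (singleWeight_pos _ _ _ _).le)
        rw [Finset.mul_sum]
        exact Finset.sum_le_univ_sum_of_nonneg fun x => by positivity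

end Bounds

/-! ### Riemann sums over the lattice cells -/

section Riemann

theorem unitBox_eq : unitBox = (WithLp.ofLp : E3 → Fin 3 → ℝ) ⁻¹'
    (Set.pi Set.univ fun _ => Set.Icc (-(1 / 2) : ℝ) (1 / 2)) := by
  ext t
  simp only [unitBox, Set.mem_preimage, Set.mem_pi, Set.mem_univ, true_imp_iff]
  rfl

theorem measurableSet_unitBox : MeasurableSet unitBox := by
  rw [unitBox_eq]
  exact (PiLp.volume_preserving_ofLp (Fin 3)).measurable
    (MeasurableSet.univ_pi fun _ => measurableSet_Icc)

theorem volume_unitBox : volume unitBox = 1 := by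
  rw [unitBox_eq, (PiLp.volume_preserving_ofLp (Fin 3)).measure_preimage
    (MeasurableSet.univ_pi fun _ => measurableSet_Icc).nullMeasurableSet,
    Set.pi_univ_Icc, Real.volume_Icc_pi]
  norm_num

instance isProbabilityMeasure_unitBox :
    IsProbabilityMeasure ((volume : Measure E3).restrict unitBox) :=
  ⟨by rw [Measure.restrict_apply_univ, volume_unitBox]⟩

/-- The half-open unit box. -/
def halfOpenBox : Set E3 := {t | ∀ i, t i ∈ Set.Ico (-(1 / 2) : ℝ) (1 / 2)}

theorem halfOpenBox_eq : halfOpenBox = (WithLp.ofLp : E3 → Fin 3 → ℝ) ⁻¹'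
    (Set.pi Set.univ fun _ => Set.Ico (-(1 / 2) : ℝ) (1 / 2)) := by
  ext t
  simp only [halfOpenBox, Set.mem_preimage, Set.mem_pi, Set.mem_univ, true_imp_iff]
  rfl

theorem measurableSet_halfOpenBox : MeasurableSet halfOpenBox := by
  rw [halfOpenBox_eq]
  exact (PiLp.volume_preserving_ofLp (Fin 3)).measurable
    (MeasurableSet.univ_pi fun _ => measurableSet_Ico)

theorem halfOpenBox_ae_eq_unitBox : halfOpenBox =ᵐ[volume] unitBox := by
  rw [halfOpenBox_eq, unitBox_eq]
  exact (PiLp.volume_preserving_ofLp (Fin 3)).quasiMeasurePreserving.preimage_ae_eq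
    Measure.pi_Ico_ae_eq_pi_Icc

/-- The lattice point whose cell contains the point `h • t`. -/
def nearest (h : ℝ) (t : E3) : Lex (Fin 3 → ℤ) := toLex fun i => ⌊h * t i + 1 / 2⌋

theorem measurableSet_nearest (h : ℝ) (S : Set (Lex (Fin 3 → ℤ))) :
    MeasurableSet {t | nearest h t ∈ S} := by
  have : Measurable fun t : E3 => fun i : Fin 3 => ⌊h * t i + 1 / 2⌋ := by
    refine measurable_pi_lambda _ fun i => Int.measurable_floor.comp ?_
    fun_prop
  exact this (MeasurableSet.of_discrete (s := toLex ⁻¹' S))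

/-- The union of the cells of the lattice box `Λ_l`, scaled by `1 / (2 l)`. -/
def region (l : ℕ) : Set E3 := {t | nearest (2 * l) t ∈ box l}

theorem measurableSet_region (l : ℕ) : MeasurableSet (region l) :=
  measurableSet_nearest _ (box l : Set (Lex (Fin 3 → ℤ)))

theorem mem_box {l : ℕ} {x : Lex (Fin 3 → ℤ)} :
    x ∈ box l ↔ ∀ i, ofLex x i ∈ Finset.Ico (-(l : ℤ)) (l : ℤ) := by
  obtain ⟨y, rfl⟩ := toLex.surjective x
  simp [box]

theorem card_box (l : ℕ) : ((box l).card : ℝ) = (2 * (l : ℝ)) ^ 3 := by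
  rw [box, Finset.card_map, Fintype.card_piFinset]
  simp only [Int.card_Ico, Finset.prod_const, Finset.card_univ, Fintype.card_fin]
  rw [show ((l : ℤ) - -(l : ℤ)).toNat = 2 * l by omega]
  push_cast
  ring

theorem latticePoint_apply (x : Lex (Fin 3 → ℤ)) (i : Fin 3) :
    latticePoint x i = ((ofLex x i : ℤ) : ℝ) := rfl

theorem sub_latticePoint_mem_halfOpenBox {s : E3} {x : Lex (Fin 3 → ℤ)} :
    s - latticePoint x ∈ halfOpenBox ↔ nearest 1 s = x := by
  have h1 : nearest 1 s = x ↔ ∀ i, ⌊s i + 1 / 2⌋ = ofLex x i := by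
    rw [nearest, ← toLex_ofLex x, toLex_inj, funext_iff]
    simp
  rw [h1, halfOpenBox, Set.mem_ofPred_eq]
  refine forall_congr' fun i => ?_
  rw [Int.floor_eq_iff, Set.mem_Ico, PiLp.sub_apply, latticePoint_apply]
  constructor <;> rintro ⟨h1, h2⟩ <;> constructor <;> linarith

/-- The mean of `u` over the cell of the lattice point `x`. -/
def cellMean {E : Type} [NormedAddCommGroup E] [NormedSpace ℝ E] (l : ℕ) (u : E3 → E)
    (x : Lex (Fin 3 → ℤ)) : E :=
  ∫ y in unitBox, u ((2 * (l : ℝ))⁻¹ • (latticePoint x + y))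

theorem integrable_cell {E : Type} [NormedAddCommGroup E] {l : ℕ} (hl : 1 ≤ l)
    {u : E3 → E} (hu : Integrable u) (x : Lex (Fin 3 → ℤ)) :
    Integrable fun y => u ((2 * (l : ℝ))⁻¹ • (latticePoint x + y)) := by
  have hl' : (2 * (l : ℝ))⁻¹ ≠ 0 := by positivity
  have h1 : Integrable fun y => u ((2 * (l : ℝ))⁻¹ • y) := hu.comp_smul hl'
  exact h1.comp_add_left (latticePoint x)

/-- Half-open cells around the lattice points are disjoint and differ from closed ones by null sets;
`(2 l)³` is the Jacobian of the rescaling. -/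
theorem sum_cellMean {l : ℕ} (hl : 1 ≤ l) {g : E3 → ℝ} (hg : Integrable g) :
    ∑ x ∈ box l, cellMean l g x = (2 * (l : ℝ)) ^ 3 * ∫ t in region l, g t := by
  set h : ℝ := 2 * (l : ℝ) with hh
  have hh0 : 0 < h := by positivity
  have hgh : Integrable fun s => g (h⁻¹ • s) := hg.comp_smul (by positivity)
  have h1 : ∀ x, cellMean l g x = ∫ s, {s | nearest 1 s = x}.indicator (fun s => g (h⁻¹ • s)) s := by
    intro x
    rw [cellMean, ← setIntegral_congr_set halfOpenBox_ae_eq_unitBox,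
      ← integral_indicator measurableSet_halfOpenBox, ← integral_sub_right_eq_self _ (latticePoint x)]
    congr 1
    funext s
    by_cases hs : nearest 1 s = x
    · rw [Set.indicator_of_mem (sub_latticePoint_mem_halfOpenBox.2 hs),
        Set.indicator_of_mem (by exact hs)]
      simp [hh]
    · rw [Set.indicator_of_notMem (fun hc => hs (sub_latticePoint_mem_halfOpenBox.1 hc)),
        Set.indicator_of_notMem (by exact hs)]
  have hm : ∀ x, MeasurableSet {s | nearest 1 s = x} := fun x =>
    measurableSet_nearest 1 {x}
  simp only [h1]
  rw [← integral_finsetSum _ fun x _ => hgh.indicator (hm x)]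
  have h2 : (fun s => ∑ x ∈ box l, {s | nearest 1 s = x}.indicator (fun s => g (h⁻¹ • s)) s)
      = fun s => (region l).indicator g (h⁻¹ • s) := by
    funext s
    have h3 : nearest h (h⁻¹ • s) = nearest 1 s := by
      simp only [nearest, PiLp.smul_apply, smul_eq_mul]
      rw [toLex_inj]
      funext i
      rw [mul_inv_cancel_left₀ hh0.ne', one_mul]
    simp only [Set.indicator_apply, Set.mem_ofPred_eq, region, ← hh, h3]
    rw [Finset.sum_ite_eq]
  rw [h2, Measure.integral_comp_inv_smul_of_nonneg _ _ hh0.le,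
    integral_indicator (measurableSet_region l), finrank_euclideanSpace_fin, smul_eq_mul]

theorem sum_cellMean_le {l : ℕ} (hl : 1 ≤ l) {g : E3 → ℝ} (hg : Integrable g) (h0 : ∀ t, 0 ≤ g t) :
    ∑ x ∈ box l, cellMean l g x ≤ (2 * (l : ℝ)) ^ 3 * ∫ t, g t := by
  rw [sum_cellMean hl hg]
  exact mul_le_mul_of_nonneg_left (setIntegral_le_integral hg (Eventually.of_forall h0))
    (by positivity)

theorem eventually_mem_region {t : E3} (ht : t ∈ halfOpenBox) : ∀ᶠ l : ℕ in atTop, t ∈ region l := by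
  have h1 : ∀ i, ∀ᶠ l : ℕ in atTop,
      ⌊2 * (l : ℝ) * t i + 1 / 2⌋ ∈ Finset.Ico (-(l : ℤ)) (l : ℤ) := by
    intro i
    obtain ⟨h1, h2⟩ := ht i
    have h3 : Tendsto (fun l : ℕ => (1 - 2 * t i) * (l : ℝ)) atTop atTop :=
      tendsto_natCast_atTop_atTop.const_mul_atTop (by linarith)
    filter_upwards [h3.eventually_gt_atTop (1 / 2)] with l hl
    rw [Finset.mem_Ico, Int.le_floor, Int.floor_lt]
    push_cast
    constructor
    · have : 0 ≤ (l : ℝ) * (2 * t i + 1) := mul_nonneg (by positivity) (by linarith)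
      linarith
    · linarith
  filter_upwards [eventually_all.2 h1] with l hl
  rw [region, Set.mem_ofPred_eq, mem_box]
  exact hl

/-- `region l` is the half-open unit box shifted by `-1 / (4 l)` in each coordinate, so it misses a
thin layer of the unit box. Every point of the half-open box is eventually covered, and dominated
convergence applies. -/
theorem tendsto_setIntegral_compl_region {g : E3 → ℝ} (hg : Integrable g)
    (h0 : ∀ t, t ∉ unitBox → g t = 0) :
    Tendsto (fun l : ℕ => ∫ t in (region l)ᶜ, g t) atTop (𝓝 0) := by
  have h1 : Tendsto (fun l : ℕ => ∫ t, (region l)ᶜ.indicator g t) atTop (𝓝 (∫ _ : E3, (0 : ℝ))) := by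
    refine tendsto_integral_of_dominated_convergence (fun t => ‖g t‖)
      (fun l => (hg.indicator (measurableSet_region l).compl).aestronglyMeasurable) hg.norm
      (fun l => Eventually.of_forall fun t => norm_indicator_le_norm_self _ _) ?_
    filter_upwards [halfOpenBox_ae_eq_unitBox.mem_iff] with t ht
    by_cases hb : t ∈ unitBox
    · refine tendsto_const_nhds.congr' ?_
      filter_upwards [eventually_mem_region (ht.2 hb)] with l hl
      exact (Set.indicator_of_notMem (show t ∉ (region l)ᶜ from fun hc => hc hl) g).symm
    · refine tendsto_const_nhds.congr fun l => ?_
      by_cases h : t ∈ (region l)ᶜ <;> simp [h, h0 t hb]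
  simpa [integral_indicator (measurableSet_region _).compl] using h1

/-- The mean oscillation of `f` in the cells of the lattice box `Λ_l`. -/
def oscillation (l : ℕ) (f : E3 → E3) : ℝ :=
  ((2 * (l : ℝ)) ^ 3)⁻¹ * ∑ x ∈ box l,
    ∫ y in unitBox, ‖cellMean l f x - f ((2 * (l : ℝ))⁻¹ • (latticePoint x + y))‖

theorem norm_le_two_of_mem_unitBox {y z : E3} (hy : y ∈ unitBox) (hz : z ∈ unitBox) :
    ‖y - z‖ ≤ 2 := by
  refine le_of_sq_le_sq ?_ (by norm_num)
  rw [EuclideanSpace.real_norm_sq_eq]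
  have : ∀ i, (y - z) i ^ 2 ≤ 1 := by
    intro i
    have h1 := hy i
    have h2 := hz i
    rw [PiLp.sub_apply, sq_le_one_iff_abs_le_one, abs_le]
    constructor <;> linarith [h1.1, h1.2, h2.1, h2.2]
  calc ∑ i, (y - z) i ^ 2 ≤ ∑ _i : Fin 3, (1 : ℝ) := Finset.sum_le_sum fun i _ => this i
    _ ≤ 2 ^ 2 := by norm_num

theorem norm_cellMean_sub_le {l : ℕ} (hl : 1 ≤ l) {f g : E3 → E3} (hf : Integrable f)
    (hg : Integrable g) (x : Lex (Fin 3 → ℤ)) :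
    ‖cellMean l f x - cellMean l g x‖ ≤ cellMean l (fun t => ‖f t - g t‖) x := by
  rw [cellMean, cellMean, ← integral_sub (integrable_cell hl hf x).integrableOn
    (integrable_cell hl hg x).integrableOn]
  exact norm_integral_le_integral_norm _

theorem oscillation_nonneg (l : ℕ) (f : E3 → E3) : 0 ≤ oscillation l f :=
  mul_nonneg (by positivity) (Finset.sum_nonneg fun _ _ => integral_nonneg fun _ => norm_nonneg _)

/-- Approximation in `L¹` by a continuous `g` of compact support. The error `f - g` counts twice, in
the cell mean and in the value, and uniform continuity of `g` bounds the third contribution. -/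
theorem tendsto_oscillation {f : E3 → E3} (hf : Integrable f) :
    Tendsto (fun l : ℕ => oscillation l f) atTop (𝓝 0) := by
  rw [Metric.tendsto_atTop]
  intro ε hε
  obtain ⟨g, hgs, hfg, hgc, hg⟩ := hf.exists_hasCompactSupport_integral_sub_le
    (show 0 < ε / 4 by positivity)
  have huc : UniformContinuous g := hgs.uniformContinuous_of_continuous hgc
  obtain ⟨δ, hδ, hgδ⟩ := Metric.uniformContinuous_iff.1 huc (ε / 4) (by positivity)
  -- Two points of a rescaled cell are at distance at most `2 / (2 l)`, which is below `δ` for such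
  -- `l`.
  obtain ⟨L, hL⟩ := exists_nat_gt (2 / δ)
  refine ⟨L + 1, fun l hl => ?_⟩
  have hl1 : 1 ≤ l := by omega
  have hlL : 2 / δ < l := hL.trans (by exact_mod_cast (by omega : L < l))
  have hl0 : (0 : ℝ) < l := by exact_mod_cast hl1
  set h : ℝ := 2 * (l : ℝ) with hh
  have hh0 : 0 < h := by positivity
  have hclose : ∀ (x : Lex (Fin 3 → ℤ)) (y z : E3), y ∈ unitBox → z ∈ unitBox →
      ‖g (h⁻¹ • (latticePoint x + y)) - g (h⁻¹ • (latticePoint x + z))‖ ≤ ε / 4 := by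
    intro x y z hy hz
    rw [← dist_eq_norm]
    refine (hgδ ?_).le
    rw [dist_eq_norm, ← smul_sub, add_sub_add_left_eq_sub, norm_smul, norm_inv, Real.norm_eq_abs,
      abs_of_pos hh0]
    have h1 := norm_le_two_of_mem_unitBox hy hz
    have h2 : 2 < l * δ := (div_lt_iff₀ hδ).1 hlL
    rw [inv_mul_lt_iff₀ hh0, hh]
    nlinarith
  have hcell : ∀ x, ∫ y in unitBox, ‖cellMean l f x - f (h⁻¹ • (latticePoint x + y))‖
      ≤ 2 * cellMean l (fun t => ‖f t - g t‖) x + ε / 4 := by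
    intro x
    set M := cellMean l (fun t => ‖f t - g t‖) x with hM
    have h1 : ∀ y ∈ unitBox, ‖cellMean l g x - g (h⁻¹ • (latticePoint x + y))‖ ≤ ε / 4 := by
      intro y hy
      have e1 : cellMean l g x - g (h⁻¹ • (latticePoint x + y))
          = ∫ z in unitBox, (g (h⁻¹ • (latticePoint x + z)) - g (h⁻¹ • (latticePoint x + y))) := by
        rw [integral_sub (integrable_cell hl1 hg x).integrableOn (integrable_const _),
          integral_const]
        simp [cellMean, hh]
      rw [e1]
      have := norm_setIntegral_le_of_norm_le_const (μ := volume) (s := unitBox) (C := ε / 4)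
        (by rw [volume_unitBox]; exact ENNReal.one_lt_top) (fun z hz => hclose x z y hz hy)
      simpa [Measure.real, volume_unitBox] using this
    have hint : IntegrableOn (fun y => ‖(fun t => f t - g t) (h⁻¹ • (latticePoint x + y))‖) unitBox :=
      (integrable_cell hl1 (hf.sub hg) x).norm.integrableOn
    have h2 : ∀ y ∈ unitBox, ‖cellMean l f x - f (h⁻¹ • (latticePoint x + y))‖
        ≤ (M + ε / 4) + ‖(fun t => f t - g t) (h⁻¹ • (latticePoint x + y))‖ := by
      intro y hy
      have e1 : cellMean l f x - f (h⁻¹ • (latticePoint x + y))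
          = (cellMean l f x - cellMean l g x) + (cellMean l g x - g (h⁻¹ • (latticePoint x + y)))
            - (f (h⁻¹ • (latticePoint x + y)) - g (h⁻¹ • (latticePoint x + y))) := by abel
      rw [e1]
      refine (norm_sub_le _ _).trans (add_le_add_left ((norm_add_le _ _).trans ?_) _)
      exact add_le_add (norm_cellMean_sub_le hl1 hf hg x) (h1 y hy)
    calc ∫ y in unitBox, ‖cellMean l f x - f (h⁻¹ • (latticePoint x + y))‖
        ≤ ∫ y in unitBox, ((M + ε / 4) + ‖(fun t => f t - g t) (h⁻¹ • (latticePoint x + y))‖) :=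
          setIntegral_mono_on
            ((integrable_const _).sub (integrable_cell hl1 hf x).integrableOn).norm
            ((integrable_const _).add hint) measurableSet_unitBox h2
      _ = (M + ε / 4) + M := by
          rw [integral_add (integrable_const _) hint, integral_const]
          simp [hM, cellMean, hh]
      _ = _ := by ring
  have hbound : oscillation l f ≤ 3 * (ε / 4) := by
    have h1 : ∑ x ∈ box l, ∫ y in unitBox, ‖cellMean l f x - f (h⁻¹ • (latticePoint x + y))‖
        ≤ h ^ 3 * (3 * (ε / 4)) := by
      calc _ ≤ ∑ x ∈ box l, (2 * cellMean l (fun t => ‖f t - g t‖) x + ε / 4) :=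
            Finset.sum_le_sum fun x _ => hcell x
        _ = 2 * ∑ x ∈ box l, cellMean l (fun t => ‖f t - g t‖) x + h ^ 3 * (ε / 4) := by
            rw [Finset.sum_add_distrib, ← Finset.mul_sum, Finset.sum_const, nsmul_eq_mul,
              card_box]
        _ ≤ 2 * (h ^ 3 * (ε / 4)) + h ^ 3 * (ε / 4) := by
            have := (sum_cellMean_le hl1 (hf.sub hg).norm fun t => norm_nonneg _).trans
              (mul_le_mul_of_nonneg_left hfg (by positivity))
            exact add_le_add_left (mul_le_mul_of_nonneg_left this (by norm_num)) _
        _ = _ := by ring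
    rw [oscillation, ← hh, inv_mul_le_iff₀ (by positivity)]
    exact h1
  rw [Real.dist_eq, sub_zero, abs_of_nonneg (oscillation_nonneg l f)]
  linarith

/-- Riemann sums of Lipschitz functions of the cell means. -/
theorem abs_riemannSum_sub_integral_le {l : ℕ} (hl : 1 ≤ l) {f : E3 → E3} (hf : Integrable f)
    (h0 : ∀ t, t ∉ unitBox → f t = 0) {K : ℝ} (hK : 0 ≤ K) {G : E3 → ℝ}
    (hG : ∀ b c, |G b - G c| ≤ K * ‖b - c‖) :
    |((2 * (l : ℝ)) ^ 3)⁻¹ * ∑ x ∈ box l, G (cellMean l f x) - ∫ t in unitBox, G (f t)|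
      ≤ K * (oscillation l f + ∫ t in (region l)ᶜ, ‖f t‖) := by
  have hl0 : (0 : ℝ) < l := by exact_mod_cast hl
  set h : ℝ := 2 * (l : ℝ) with hh
  have hh0 : 0 < h := by positivity
  have hGc : Continuous G := by
    refine (LipschitzWith.of_dist_le_mul (K := ⟨K, hK⟩) fun b c => ?_).continuous
    rw [Real.dist_eq, dist_eq_norm]
    exact hG b c
  -- Subtracting `G 0` makes the function vanish outside the unit box, hence integrable on all of
  -- `E3`, as needed for cells that stick out of the box.
  set u : E3 → ℝ := fun t => G (f t) - G 0 with hu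
  have hule : ∀ t, |u t| ≤ K * ‖f t‖ := fun t => by simpa using hG (f t) 0
  have hui : Integrable u := by
    refine (hf.norm.const_mul K).mono' ?_ (Eventually.of_forall hule)
    exact (hGc.comp_aestronglyMeasurable hf.aestronglyMeasurable).sub aestronglyMeasurable_const
  have e1 : ∫ t in unitBox, G (f t) = G 0 + ∫ t, u t := by
    have : ∫ t, u t = ∫ t in unitBox, u t := by
      rw [setIntegral_eq_integral_of_forall_compl_eq_zero]
      intro t ht
      simp [hu, h0 t ht]
    rw [this]
    have h2 : ∀ t, G (f t) = G 0 + u t := fun t => by simp [hu]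
    simp only [h2]
    rw [integral_add (integrable_const _) hui.integrableOn, integral_const]
    simp
  have e2 : ∫ t, u t = (h ^ 3)⁻¹ * ∑ x ∈ box l, cellMean l u x + ∫ t in (region l)ᶜ, u t := by
    rw [sum_cellMean hl hui, ← hh, inv_mul_cancel_left₀ (by positivity),
      integral_add_compl (measurableSet_region l) hui]
  have e3 : (h ^ 3)⁻¹ * ∑ x ∈ box l, G (cellMean l f x)
      = G 0 + (h ^ 3)⁻¹ * ∑ x ∈ box l, (G (cellMean l f x) - G 0) := by
    rw [Finset.sum_sub_distrib, Finset.sum_const, nsmul_eq_mul, card_box, ← hh]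
    field_simp
    ring
  have h3 : |(h ^ 3)⁻¹ * ∑ x ∈ box l, (G (cellMean l f x) - G 0 - cellMean l u x)|
      ≤ K * oscillation l f := by
    rw [abs_mul, abs_of_pos (by positivity), oscillation, ← hh, mul_left_comm, Finset.mul_sum]
    refine mul_le_mul_of_nonneg_left ?_ (by positivity)
    refine (Finset.abs_sum_le_sum_abs _ _).trans (Finset.sum_le_sum fun x _ => ?_)
    have hci := (integrable_cell hl hui x).integrableOn (s := unitBox)
    have e4 : G (cellMean l f x) - G 0 - cellMean l u x
        = ∫ y in unitBox, (G (cellMean l f x) - G 0 - u (h⁻¹ • (latticePoint x + y))) := by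
      rw [integral_sub (integrable_const _) hci, integral_const]
      simp [cellMean]
    rw [e4, ← integral_const_mul, ← Real.norm_eq_abs]
    refine (norm_integral_le_integral_norm _).trans ?_
    refine integral_mono ((integrable_const _).sub hci).norm
      (((integrable_const _).sub (integrable_cell hl hf x).integrableOn).norm.const_mul K)
      fun y => ?_
    simp only [hu, Real.norm_eq_abs, sub_sub_sub_cancel_right]
    exact hG _ _
  have h4 : |∫ t in (region l)ᶜ, u t| ≤ K * ∫ t in (region l)ᶜ, ‖f t‖ := by
    rw [← integral_const_mul, ← Real.norm_eq_abs]
    refine (norm_integral_le_integral_norm _).trans ?_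
    exact integral_mono hui.norm.integrableOn (hf.norm.const_mul K).integrableOn hule
  have e5 : (h ^ 3)⁻¹ * ∑ x ∈ box l, G (cellMean l f x) - ∫ t in unitBox, G (f t)
      = (h ^ 3)⁻¹ * ∑ x ∈ box l, (G (cellMean l f x) - G 0 - cellMean l u x)
        - ∫ t in (region l)ᶜ, u t := by
    rw [e1, e2, e3, Finset.sum_sub_distrib _ (fun x => cellMean l u x)]
    ring
  rw [e5, mul_add, sub_eq_add_neg]
  refine (abs_add_le _ _).trans (add_le_add h3 ?_)
  rwa [abs_neg]

end Riemann

/-! ### The thermodynamic limit of the pressure -/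

section ThermodynamicLimit

/-- The magnetic induction, extended by zero outside the unit box. -/
def extend (B : L2Box) : E3 → E3 := unitBox.indicator B

theorem integrableOn_L2Box (B : L2Box) : IntegrableOn B unitBox :=
  (Lp.memLp B).integrable (by norm_num)

theorem integrable_extend (B : L2Box) : Integrable (extend B) :=
  (integrable_indicator_iff measurableSet_unitBox).2 (integrableOn_L2Box B)

theorem extend_of_notMem (B : L2Box) {t : E3} (ht : t ∉ unitBox) : extend B t = 0 :=
  Set.indicator_of_notMem ht _

theorem cellField_eq {l : ℕ} (hl : 1 ≤ l) (B : L2Box) (x : Lex (Fin 3 → ℤ)) (j : Fin 3) :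
    cellField l B x j = cellMean l (extend B) x j := by
  have := (EuclideanSpace.proj j : E3 →L[ℝ] ℝ).integral_comp_comm
    ((integrable_cell hl (integrable_extend B) x).integrableOn (s := unitBox))
  exact this

theorem hamiltonian_eq {l : ℕ} (hl : 1 ≤ l) (μ lam γ th : ℝ) (B : L2Box) :
    hamiltonian μ lam γ th l B
      = fieldHamiltonian μ lam γ th fun x : box l => cellMean l (extend B) x.1 := by
  simp only [hamiltonian, magneticTerm, fieldHamiltonian, cellField_eq hl]

/-- The logarithm of the partition function of a site. -/
def siteLog (β μ lam γ th r : ℝ) (b : E3) : ℝ :=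
  Real.log (singleWeight β μ th b + pairWeight β μ lam γ r)

theorem siteLog_le {β th : ℝ} (hβ : 0 < β) (hth : 0 < th) (μ lam γ r : ℝ) (b c : E3) :
    siteLog β μ lam γ th r b ≤ siteLog β μ lam γ th r c + β * th * ‖b - c‖ := by
  have hz := pairWeight_pos β μ lam γ r
  have hb := singleWeight_pos β μ th b
  have hc := singleWeight_pos β μ th c
  rw [siteLog, siteLog, ← Real.log_exp (β * th * ‖b - c‖),
    ← Real.log_mul (by positivity) (Real.exp_ne_zero _)]
  refine Real.log_le_log (by positivity) ?_
  have h1 : 1 ≤ Real.exp (β * th * ‖b - c‖) := Real.one_le_exp (by positivity)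
  have h2 := singleWeight_le hβ hth μ b c
  nlinarith

theorem abs_siteLog_sub_le {β th : ℝ} (hβ : 0 < β) (hth : 0 < th) (μ lam γ r : ℝ) (b c : E3) :
    |siteLog β μ lam γ th r b - siteLog β μ lam γ th r c| ≤ β * th * ‖b - c‖ := by
  have h1 := siteLog_le hβ hth μ lam γ r b c
  have h2 := siteLog_le hβ hth μ lam γ r c b
  rw [norm_sub_rev] at h2
  rw [abs_le]
  constructor <;> linarith

theorem continuous_siteLog (β μ lam γ th r : ℝ) : Continuous (siteLog β μ lam γ th r) := by
  unfold siteLog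
  refine Continuous.log ?_ fun b =>
    (add_pos (singleWeight_pos β μ th b) (pairWeight_pos β μ lam γ r)).ne'
  unfold singleWeight
  have := Real.continuous_cosh
  fun_prop

theorem integrableOn_siteLog {β th : ℝ} (hβ : 0 < β) (hth : 0 < th) (μ lam γ r : ℝ) (B : L2Box) :
    IntegrableOn (fun t => siteLog β μ lam γ th r (B t)) unitBox := by
  refine Integrable.mono' ((integrable_const |siteLog β μ lam γ th r 0|).add
    ((integrableOn_L2Box B).norm.const_mul (β * th)))
    ((continuous_siteLog β μ lam γ th r).comp_aestronglyMeasurable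
      (integrableOn_L2Box B).aestronglyMeasurable) (Eventually.of_forall fun t => ?_)
  have h1 := abs_siteLog_sub_le hβ hth μ lam γ r (B t) 0
  rw [sub_zero] at h1
  have h2 := abs_sub_abs_le_abs_sub (siteLog β μ lam γ th r (B t)) (siteLog β μ lam γ th r 0)
  rw [Real.norm_eq_abs]
  simp only [Pi.add_apply]
  linarith

theorem functionalF_eq (β μ lam γ th r : ℝ) (B : L2Box) :
    functionalF β μ lam γ th r B
      = -γ * r + β⁻¹ * ∫ t in unitBox, siteLog β μ lam γ th r (extend B t) := by
  rw [functionalF]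
  congr 2
  refine setIntegral_congr_fun measurableSet_unitBox fun t ht => ?_
  simp only [logPartition_oneSite, siteLog, extend, Set.indicator_of_mem ht]

/-- The deviation of the cell means of `B` from `B`. -/
def meanError (l : ℕ) (B : L2Box) : ℝ :=
  oscillation l (extend B) + ∫ t in (region l)ᶜ, ‖extend B t‖

theorem tendsto_meanError (B : L2Box) : Tendsto (fun l => meanError l B) atTop (𝓝 0) := by
  have := (tendsto_oscillation (integrable_extend B)).add
    (tendsto_setIntegral_compl_region (integrable_extend B).norm fun t ht => by
      rw [extend_of_notMem B ht, norm_zero])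
  simpa [meanError] using this

variable {β γ th : ℝ} (hβ : 0 < β) (hγ : 0 < γ) (hth : 0 < th) (μ lam : ℝ)

theorem nonempty_box {l : ℕ} (hl : 1 ≤ l) : Nonempty (box l) := by
  refine ⟨⟨toLex fun _ => 0, mem_box.2 fun i => ?_⟩⟩
  simp only [ofLex_toLex, Finset.mem_Ico]
  omega

theorem pressure_eq {l : ℕ} (hl : 1 ≤ l) (β μ lam γ th : ℝ) (B : L2Box) :
    pressure β μ lam γ th l B = (β * (2 * (l : ℝ)) ^ 3)⁻¹ *
      Real.log (partitionFunction β μ lam γ th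
        fun x : box l => cellMean l (extend B) x.1) := by
  rw [pressure, card_box, hamiltonian_eq hl, logPartition_fieldHamiltonian]

theorem card_box_subtype (l : ℕ) : (Fintype.card (box l) : ℝ) = (2 * (l : ℝ)) ^ 3 := by
  rw [Fintype.card_coe, card_box]

include hβ hth in
theorem abs_sum_siteLog_sub_le {l : ℕ} (hl : 1 ≤ l) (B : L2Box) (r : ℝ) :
    |(-γ * r + (β * (2 * (l : ℝ)) ^ 3)⁻¹ *
      ∑ x : box l, siteLog β μ lam γ th r (cellMean l (extend B) x.1))
        - functionalF β μ lam γ th r B| ≤ th * meanError l B := by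
  have h := abs_riemannSum_sub_integral_le hl (integrable_extend B)
    (fun t ht => extend_of_notMem B ht) (by positivity : 0 ≤ β * th)
    (abs_siteLog_sub_le hβ hth μ lam γ r)
  have e1 : ∑ x : box l, siteLog β μ lam γ th r (cellMean l (extend B) x.1)
      = ∑ x ∈ box l, siteLog β μ lam γ th r (cellMean l (extend B) x) :=
    Finset.sum_coe_sort (box l) fun x => siteLog β μ lam γ th r (cellMean l (extend B) x)
  rw [e1, functionalF_eq, add_sub_add_left_eq_sub, mul_inv, mul_assoc, ← mul_sub, abs_mul,
    abs_of_pos (inv_pos.2 hβ), inv_mul_le_iff₀ hβ, ← mul_assoc]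
  exact h

include hβ hγ hth in
theorem functionalF_le_pressure {l : ℕ} (hl : 1 ≤ l) (B : L2Box) {r : ℝ} (hr : 0 ≤ r) :
    functionalF β μ lam γ th r B ≤ pressure β μ lam γ th l B + th * meanError l B := by
  have hl0 : (0 : ℝ) < l := by exact_mod_cast hl
  have := nonempty_box hl
  have h1 := le_partitionFunction hβ hγ μ lam th
    (fun x : box l => cellMean l (extend B) x.1) hr
  have hpos : ∀ x : box l, 0 < singleWeight β μ th (cellMean l (extend B) x.1)
      + pairWeight β μ lam γ r := fun x =>
    add_pos (singleWeight_pos _ _ _ _) (pairWeight_pos _ _ _ _ _)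
  have h2 := Real.log_le_log (mul_pos (Real.exp_pos _) (Finset.prod_pos fun x _ => hpos x)) h1
  rw [Real.log_mul (Real.exp_ne_zero _) (Finset.prod_pos fun x _ => hpos x).ne', Real.log_exp,
    Real.log_prod fun x _ => (hpos x).ne', card_box_subtype] at h2
  have h3 := abs_le.1 (abs_sum_siteLog_sub_le (γ := γ) hβ hth μ lam hl B r)
  have h4 : -γ * r + (β * (2 * (l : ℝ)) ^ 3)⁻¹ *
      ∑ x : box l, siteLog β μ lam γ th r (cellMean l (extend B) x.1)
      ≤ pressure β μ lam γ th l B := by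
    rw [pressure_eq hl]
    refine le_trans (le_of_eq ?_) (mul_le_mul_of_nonneg_left h2 (by positivity))
    simp only [siteLog]
    field_simp
  linarith [h3.1]

-- The factor `(N + 1) ^ 3 * exp (β γ)` of `partitionFunction_le` has a logarithm of at most `(18 +
-- β γ) l`, negligible against the volume `8 l³`; the resulting error is independent of `B`.
include hβ hγ hth in
theorem pressure_le {l : ℕ} (hl : 1 ≤ l) (B : L2Box) {S : ℝ}
    (hS : ∀ r, 0 ≤ r → functionalF β μ lam γ th r B ≤ S) :
    pressure β μ lam γ th l B ≤ S + th * meanError l B + ((18 + β * γ) / β) / l := by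
  have hl0 : (0 : ℝ) < l := by exact_mod_cast hl
  have hl1 : (1 : ℝ) ≤ l := by exact_mod_cast hl
  have := nonempty_box hl
  set N : ℝ := (2 * (l : ℝ)) ^ 3 with hN
  have hN0 : 0 < N := by positivity
  -- A bound for all `r` at once: the Riemann sum error `th * meanError l B` does not depend on `r`.
  set M : ℝ := Real.exp (β * N * (S + th * meanError l B)) with hM
  have h1 := partitionFunction_le (M := M) hβ hγ μ lam th
    (fun x : box l => cellMean l (extend B) x.1) (fun r hr => by
      have hpos : ∀ x : box l, 0 < singleWeight β μ th (cellMean l (extend B) x.1)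
          + pairWeight β μ lam γ r := fun x =>
        add_pos (singleWeight_pos _ _ _ _) (pairWeight_pos _ _ _ _ _)
      have h2 : ∏ x : box l, (singleWeight β μ th (cellMean l (extend B) x.1)
          + pairWeight β μ lam γ r)
          = Real.exp (∑ x : box l, siteLog β μ lam γ th r (cellMean l (extend B) x.1)) := by
        rw [Real.exp_sum]
        exact Finset.prod_congr rfl fun x _ => (Real.exp_log (hpos x)).symm
      rw [h2, ← Real.exp_add, hM, card_box_subtype, ← hN]
      refine Real.exp_le_exp.2 ?_
      have h3 := (abs_le.1 (abs_sum_siteLog_sub_le (γ := γ) hβ hth μ lam hl B r)).2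
      rw [← hN] at h3
      have h4 : -γ * r + (β * N)⁻¹ *
          ∑ x : box l, siteLog β μ lam γ th r (cellMean l (extend B) x.1)
          ≤ S + th * meanError l B := by linarith [hS r hr]
      have h5 := mul_le_mul_of_nonneg_left h4 (by positivity : 0 ≤ β * N)
      refine le_trans (le_of_eq ?_) h5
      field_simp)
  have h2 := Real.log_le_log (partitionFunction_pos hβ hγ μ lam th _) h1
  rw [card_box_subtype, ← hN, Real.log_mul (by positivity) (by positivity), Real.log_pow,
    Real.log_mul (by positivity) (by positivity), hM, Real.log_exp, Real.log_exp] at h2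
  have hlog : Real.log (N + 1) ≤ 6 * l := by
    calc Real.log (N + 1) ≤ Real.log ((2 * (l : ℝ) + 1) ^ 3) := by
          refine Real.log_le_log (by positivity) ?_
          rw [hN]
          nlinarith [sq_nonneg (l : ℝ)]
      _ = 3 * Real.log (2 * l + 1) := by
          rw [Real.log_pow]
          norm_num
      _ ≤ 3 * (2 * l) := by
          have := Real.log_le_sub_one_of_pos (show (0 : ℝ) < 2 * l + 1 by positivity)
          linarith
      _ = 6 * l := by ring
  have hbl : β * γ ≤ β * γ * l := le_mul_of_one_le_right (by positivity) hl1
  have h3 : Real.log (partitionFunction β μ lam γ th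
        fun x : box l => cellMean l (extend B) x.1)
      ≤ (18 + β * γ) * l + β * N * (S + th * meanError l B) := by
    push_cast at h2
    linarith
  rw [pressure_eq hl, ← hN]
  refine (mul_le_mul_of_nonneg_left h3 (by positivity)).trans ?_
  rw [mul_add, inv_mul_cancel_left₀ (by positivity), add_comm]
  refine add_le_add le_rfl ?_
  rw [inv_mul_le_iff₀ (by positivity)]
  have h4 : β * N * ((18 + β * γ) / β / l) = (18 + β * γ) * (8 * (l : ℝ) ^ 2) := by
    rw [hN]
    field_simp
    ring
  rw [h4]
  refine mul_le_mul_of_nonneg_left ?_ (by positivity)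
  nlinarith

include hβ hγ hth in
theorem exists_tendsto_pressure (B : L2Box) :
    ∃ S, Tendsto (fun l : ℕ => pressure β μ lam γ th l B) atTop (𝓝 S) ∧
      IsLUB ((fun r : ℝ => functionalF β μ lam γ th r B) '' Set.Ici 0) S := by
  set s := (fun r : ℝ => functionalF β μ lam γ th r B) '' Set.Ici 0 with hs
  have hne : s.Nonempty := ⟨_, 0, Set.self_mem_Ici, rfl⟩
  have hub : ∀ {l : ℕ}, 1 ≤ l → pressure β μ lam γ th l B + th * meanError l B ∈ upperBounds s := by
    rintro l hl _ ⟨r, hr, rfl⟩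
    exact functionalF_le_pressure hβ hγ hth μ lam hl B hr
  -- The supremum is finite because the pressure at `l = 1`, plus its error, is already an upper
  -- bound.
  have hlub : IsLUB s (sSup s) := isLUB_csSup hne ⟨_, hub le_rfl⟩
  refine ⟨sSup s, ?_, hlub⟩
  have h1 : Tendsto (fun l : ℕ => sSup s - th * meanError l B) atTop (𝓝 (sSup s)) := by
    simpa using ((tendsto_meanError B).const_mul th).const_sub (sSup s)
  have h2 : Tendsto (fun l : ℕ => sSup s + th * meanError l B + ((18 + β * γ) / β) / l) atTop
      (𝓝 (sSup s)) := by
    simpa using (((tendsto_meanError B).const_mul th).const_add (sSup s)).add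
      (tendsto_const_div_atTop_nhds_zero_nat ((18 + β * γ) / β))
  refine tendsto_of_tendsto_of_tendsto_of_le_of_le' h1 h2 ?_ ?_
  · filter_upwards [eventually_ge_atTop 1] with l hl
    linarith [hlub.2 (hub hl)]
  · filter_upwards [eventually_ge_atTop 1] with l hl
    exact pressure_le hβ hγ hth μ lam hl B fun r hr => hlub.1 ⟨r, hr, rfl⟩

/-- The unit box has volume one, so the `L¹` norm is at most the `L²` norm. -/
theorem integral_norm_extend_sub_le (B C : L2Box) :
    ∫ t, ‖extend B t - extend C t‖ ≤ ‖B - C‖ := by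
  have h1 : ∫ t, ‖extend B t - extend C t‖ = ∫ t in unitBox, ‖(B - C : L2Box) t‖ := by
    rw [← integral_indicator measurableSet_unitBox]
    have h2 := (ae_restrict_iff' measurableSet_unitBox).1 (Lp.coeFn_sub B C)
    refine integral_congr_ae ?_
    filter_upwards [h2] with t ht
    by_cases hb : t ∈ unitBox
    · simp only [extend, Set.indicator_of_mem hb, ht hb, Pi.sub_apply]
    · simp [extend, Set.indicator_of_notMem hb]
  have hm := Lp.memLp (B - C)
  rw [h1, Lp.norm_def, integral_norm_eq_lintegral_enorm hm.aestronglyMeasurable,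
    ← eLpNorm_one_eq_lintegral_enorm]
  exact ENNReal.toReal_mono hm.eLpNorm_ne_top
    (eLpNorm_le_eLpNorm_of_exponent_le (by norm_num) hm.aestronglyMeasurable)

include hβ hγ hth in
theorem pressure_sub_le {l : ℕ} (hl : 1 ≤ l) (B C : L2Box) :
    pressure β μ lam γ th l B - pressure β μ lam γ th l C ≤ th * ‖B - C‖ := by
  have hl0 : (0 : ℝ) < l := by exact_mod_cast hl
  have := nonempty_box hl
  have h1 := log_partitionFunction_le hβ hγ hth μ lam
    (fun x : box l => cellMean l (extend B) x.1) (fun x : box l => cellMean l (extend C) x.1)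
  have hint := (integrable_extend B).sub (integrable_extend C)
  have h2 : ∑ x : box l, ‖cellMean l (extend B) x.1 - cellMean l (extend C) x.1‖
      ≤ (2 * (l : ℝ)) ^ 3 * ‖B - C‖ := by
    rw [Finset.sum_coe_sort (box l) fun x => ‖cellMean l (extend B) x - cellMean l (extend C) x‖]
    refine (Finset.sum_le_sum fun x _ => norm_cellMean_sub_le hl (integrable_extend B)
      (integrable_extend C) x).trans ?_
    refine (sum_cellMean_le hl hint.norm fun t => norm_nonneg _).trans ?_
    exact mul_le_mul_of_nonneg_left (integral_norm_extend_sub_le B C) (by positivity)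
  have h3 := mul_le_mul_of_nonneg_left h2 (by positivity : 0 ≤ β * th)
  rw [pressure_eq hl, pressure_eq hl, ← mul_sub, inv_mul_le_iff₀ (by positivity)]
  linarith

include hβ hγ hth in
theorem abs_pressure_sub_le {l : ℕ} (hl : 1 ≤ l) (B C : L2Box) :
    |pressure β μ lam γ th l B - pressure β μ lam γ th l C| ≤ 2 * √3 * th * ‖B - C‖ := by
  have h1 := pressure_sub_le hβ hγ hth μ lam hl B C
  have h2 := pressure_sub_le hβ hγ hth μ lam hl C B
  rw [norm_sub_rev] at h2
  -- The preceding bounds hold with the smaller constant `th`.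
  have h3 : (1 : ℝ) ≤ 2 * √3 := by
    have : (1 : ℝ) ≤ √3 := Real.one_le_sqrt.2 (by norm_num)
    linarith
  have h4 : th * ‖B - C‖ ≤ 2 * √3 * th * ‖B - C‖ := by
    rw [mul_assoc (2 * √3)]
    exact le_mul_of_one_le_left (by positivity) h3
  rw [abs_le]
  constructor <;> linarith

end ThermodynamicLimit

end BCSHubbard

end

/-! ### The infinite volume pressure and its Lipschitz continuity. -/

theorem mainTheorem7 (β μ lam γ th : ℝ) (hβ : 0 < β) (hγ : 0 < γ) (hth : 0 < th) :
    (∀ B : BCSHubbard.L2Box,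
      (∀ r : ℝ, 0 ≤ r →
        IntegrableOn
          (fun t => BCSHubbard.logPartition β (BCSHubbard.oneSite μ lam γ th r (B t)))
          BCSHubbard.unitBox volume) ∧
      Tendsto (fun l : ℕ => BCSHubbard.pressure β μ lam γ th l B) atTop
        (𝓝 (BCSHubbard.pressureLim β μ lam γ th B)) ∧
      IsLUB ((fun r : ℝ => BCSHubbard.functionalF β μ lam γ th r B) '' Set.Ici 0)
        (BCSHubbard.pressureLim β μ lam γ th B)) ∧
    (∀ B C : BCSHubbard.L2Box,
      (∀ l : ℕ, 1 ≤ l →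
        |BCSHubbard.pressure β μ lam γ th l B - BCSHubbard.pressure β μ lam γ th l C|
          ≤ 2 * Real.sqrt 3 * th * ‖B - C‖) ∧
      |BCSHubbard.pressureLim β μ lam γ th B - BCSHubbard.pressureLim β μ lam γ th C|
        ≤ 2 * Real.sqrt 3 * th * ‖B - C‖) := by
  have hlim : ∀ B : BCSHubbard.L2Box,
      Tendsto (fun l : ℕ => BCSHubbard.pressure β μ lam γ th l B) atTop
        (𝓝 (BCSHubbard.pressureLim β μ lam γ th B)) ∧
      IsLUB ((fun r : ℝ => BCSHubbard.functionalF β μ lam γ th r B) '' Set.Ici 0)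
        (BCSHubbard.pressureLim β μ lam γ th B) := by
    intro B
    obtain ⟨S, h1, h2⟩ := BCSHubbard.exists_tendsto_pressure hβ hγ hth μ lam B
    -- `limUnder` carries information only once convergence is known; here it becomes the actual
    -- limit.
    have h3 : BCSHubbard.pressureLim β μ lam γ th B = S := h1.limUnder_eq
    rw [h3]
    exact ⟨h1, h2⟩
  refine ⟨fun B => ⟨fun r _ => ?_, hlim B⟩, fun B C => ⟨fun l hl => ?_, ?_⟩⟩
  · simp only [BCSHubbard.logPartition_oneSite]
    exact BCSHubbard.integrableOn_siteLog hβ hth μ lam γ r B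
  · exact BCSHubbard.abs_pressure_sub_le hβ hγ hth μ lam hl B C
  · refine le_of_tendsto ((hlim B).1.sub (hlim C).1).abs ?_
    filter_upwards [eventually_ge_atTop 1] with l hl
    exact BCSHubbard.abs_pressure_sub_le hβ hγ hth μ lam hl B C
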